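/- Let $A=(A_{ij})_{1\le i,j\le l}$ be the Cartan matrix of a finite-dimensional simple Lie algebra $\mathfrak g$, with positive rationals $d_i$ such that $(\alpha_i|\alpha_j)=d_iA_{ij}$ is symmetric (for the standard normalized form the largest $d_i$ is $1$). Let $q=e^h\in\mathbb C^*$ not be a root of unity, and put $q^a=e^{ah}$ for $a\in\mathbb Q$, $q_i=q^{d_i}$, $[a]=\frac{q^a-q^{-a}}{q-q^{-1}}$, $\delta(u)=\sum_{n\in\mathbb Z}u^n$. Let $U_q(\widehat{\mathfrak g})$ be the untwisted (type one) quantum affine algebra in Drinfeld's realization: the associative $\mathbb C$-algebra generated by central elements $\gamma^{\pm1/2}$ and by $d$, $k_i^{\pm1}$, $a_i(n)$ $(n\ne0)$, $x_i^\pm(n)$ $(n\in\mathbb Z)$, where the $k_i$ commute with each other, with $d$ and with all $a_j(n)$, and, with $x_i^\pm(z)=\sum_{n\in\mathbb Z}x_i^\pm(n)z^{-n}$, $$k_ix_j^\pm(n)k_i^{-1}=q^{\pm(\alpha_i|\alpha_j)}x_j^\pm(n),\quad [d,a_i(n)]=na_i(n),\quad [d,x_i^\pm(n)]=nx_i^\pm(n),$$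 $$[a_i(m),a_j(n)]=\delta_{m,-n}\tfrac{[(\alpha_i|\alpha_j)m]}{m}\tfrac{\gamma^m-\gamma^{-m}}{q-q^{-1}},\quad [a_i(m),x_j^\pm(n)]=\pm\tfrac{[(\alpha_i|\alpha_j)m]}{m}\gamma^{\mp|m|/2}x_j^\pm(m+n),$$ $$(z-q^{\pm(\alpha_i|\alpha_j)}w)x_i^\pm(z)x_j^\pm(w)=(q^{\pm(\alpha_i|\alpha_j)}z-w)x_j^\pm(w)x_i^\pm(z),$$ $$[x_i^+(z),x_j^-(w)]=\tfrac{\delta_{ij}}{q_i-q_i^{-1}}\{\delta(\gamma^{-1}z/w)\psi_i(\gamma^{1/2}w)-\delta(\gamma z/w)\phi_i(\gamma^{1/2}z)\},$$ where $\psi_i(z)=k_i\exp\big((q-q^{-1})\sum_{n>0}a_i(n)z^{-n}\big)$ and $\phi_i(z)=k_i^{-1}\exp\big((q^{-1}-q)\sum_{n>0}a_i(-n)z^n\big)$, together with the Serre relations, for $i\neq j$ and $N=1-A_{ij}$, $$\mathrm{Sym}_{z_1,\dots,z_N}\sum_{s=0}^{N}(-1)^s\begin{bmatrix}N\\s\end{bmatrix}_{q_i}x_i^\pm(z_1)\cdots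 x_i^\pm(z_s)x_j^\pm(w)x_i^\pm(z_{s+1})\cdots x_i^\pm(z_N)=0.$$ Let $k\in\mathbb Q$, $k\ne0$, and let $V$ be a $U_q(\widehat{\mathfrak g})$-module of level $k$ (that is, $\gamma^{1/2}$ acts as $q^{k/2}$) which is the sum of its subspaces $V_c=\{v: dv=cv\}$, $c\in\mathbb C$, and such that for every $c\in\mathbb C$ one has $V_{c+n}=0$ for all sufficiently large integers $n$. On $V$ put $$E_-^\pm(\alpha_i,z)=\exp\Big(\mp\sum_{n\ge1}\tfrac{q^{\mp kn/2}}{[kn]}a_i(-n)z^n\Big),\qquad E_+^\pm(\alpha_i,z)=\exp\Big(\pm\sum_{n\ge1}\tfrac{q^{\mp kn/2}}{[kn]}a_i(n)z^{-n}\Big),$$ $$Z^\pm(\alpha_i,z)=E_-^\pm(\alpha_i,z)\,x_i^\pm(z)\,E_+^\pm(\alpha_i,z),\qquad (1-u)_{q^{2k}}^{a/k}=\exp\Big(-\sum_{n\ge1}\tfrac{[an]}{n[kn]}u^n\Big)\quad(a\in\mathbb Q),$$ the last series being $(q^{-a+k}u;q^{2k})_\infty/(q^{a+k}u;q^{2k})_\infty$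 when $|q^{2k}|<1$. Then the components of $Z^\pm(\alpha_i,z)=\sum_{n\in\mathbb Z}Z_i^\pm(n)z^{-n}$ are well-defined linear operators on $V$ (on each vector they are sums with finitely many nonzero terms), for each $v\in V$ one has $Z_i^\pm(n)v=0$ for all sufficiently large $n$, and for all $i,j$ and both signs $$(1-q^{\mp k}w/z)_{q^{2k}}^{(\alpha_i|\alpha_j)/k}(z-q^{\pm(\alpha_i|\alpha_j)}w)Z^\pm(\alpha_i,z)Z^\pm(\alpha_j,w)=(1-q^{\mp k}z/w)_{q^{2k}}^{(\alpha_i|\alpha_j)/k}(q^{\pm(\alpha_i|\alpha_j)}z-w)Z^\pm(\alpha_j,w)Z^\pm(\alpha_i,z),$$ $$(1-w/z)_{q^{2k}}^{-(\alpha_i|\alpha_j)/k}Z^+(\alpha_i,z)Z^-(\alpha_j,w)-(1-z/w)_{q^{2k}}^{-(\alpha_i|\alpha_j)/k}Z^-(\alpha_j,w)Z^+(\alpha_i,z)=\frac{\delta_{ij}}{q_i-q_i^{-1}}\{k_i\,\delta(q^{-k}z/w)-k_i^{-1}\,\delta(q^kz/w)\}.$$ (These relations are taken as the defining relations of the homogeneous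 quantum $Z$-algebra.) -/

import Mathlib

open PowerSeries

noncomputable section

namespace QuantumZ

/-! ## Powers of `q`, `q`-numbers, formal exponentials -/

/-- The parameter `q = e^h` is given together with a logarithm `h`, so that all rational powers
`q^a = e^{a h}` are defined compatibly. -/
def qpow (h : ℂ) (a : ℚ) : ℂ := Complex.exp ((a : ℂ) * h)

/-- The `q`-number `[a] = (q^a - q^{-a}) / (q - q^{-1})`. -/
def qnum (h : ℂ) (a : ℚ) : ℂ :=
  (qpow h a - qpow h (-a)) / (qpow h 1 - qpow h (-1))

/-- The `q`-factorial `[n]! = [1] ⋯ [n]` with respect to `q^c`, i.e. built from the numbers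
`(q^{cr} - q^{-cr}) / (q^c - q^{-c})`. -/
def qfactorial (h : ℂ) (c : ℚ) (n : ℕ) : ℂ :=
  ∏ r ∈ Finset.range n,
    (qpow h (c * (r + 1)) - qpow h (-(c * (r + 1)))) / (qpow h c - qpow h (-c))

/-- The Gaussian binomial coefficient `[m]! / ([n]! [m-n]!)` with respect to `q^c`, used for `n ≤ m`. -/
def qbinomial (h : ℂ) (c : ℚ) (m n : ℕ) : ℂ :=
  qfactorial h c m / (qfactorial h c n * qfactorial h c (m - n))

/-- The exponential `∑ f^r / r!` of a formal power series `f` with zero constant term, with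
coefficients in a possibly noncommutative algebra. Since `f` has no constant term, `f^r` contributes
to the coefficient of `X^n` only for `r ≤ n`. -/
def formalExp {A : Type*} [Ring A] [Algebra ℂ A] (f : A⟦X⟧) : A⟦X⟧ :=
  PowerSeries.mk fun n =>
    ∑ r ∈ Finset.range (n + 1), ((r.factorial : ℂ)⁻¹) • PowerSeries.coeff n (f ^ r)

/-- `(1 - u)_{q^{2k}}^{a/k} = exp (- ∑_{n ≥ 1} [a n] / (n [k n]) u^n)` as a power series in `u`. -/
def qPochhammerPow (h : ℂ) (k a : ℚ) : ℂ⟦X⟧ :=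
  formalExp (PowerSeries.mk fun n => -(qnum h (a * n) / ((n : ℂ) * qnum h (k * n))))

/-! ## Cartan data of finite type -/

/-- An indecomposable Cartan matrix of finite type (the Cartan matrix of a finite-dimensional simple
Lie algebra) with positive rationals `d i` such that `(α_i|α_j) = d_i A_{ij}` is symmetric; the
standard normalization of the form is the one in which the largest `d i` is `1`. -/
structure CartanDatum (ι : Type*) [Fintype ι] where
  A : Matrix ι ι ℤ
  d : ι → ℚ
  nonempty : Nonempty ι
  diag : ∀ i, A i i = 2
  offDiag : ∀ i j, i ≠ j → A i j ≤ 0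
  d_pos : ∀ i, 0 < d i
  symm : ∀ i j, d i * (A i j : ℚ) = d j * (A j i : ℚ)
  posDef : ∀ c : ι → ℚ, c ≠ 0 → 0 < ∑ i, ∑ j, c i * (d i * (A i j : ℚ)) * c j
  indecomposable : ∀ s : Set ι, s.Nonempty → sᶜ.Nonempty → ∃ i ∈ s, ∃ j ∈ sᶜ, A i j ≠ 0

/-- The invariant form `(α_i|α_j) = d_i A_{ij}`. -/
def CartanDatum.form {ι : Type*} [Fintype ι] (C : CartanDatum ι) (i j : ι) : ℚ :=
  C.d i * (C.A i j : ℚ)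

/-! ## The quantum affine algebra in Drinfeld's realization -/

/-- The generators: `γ^{±1/2}`, `d`, `k_i^{±1}`, `a_i(n)` for `n ≠ 0`, and `x_i^±(n)`
(the sign is a unit of `ℤ`). -/
inductive Gen (ι : Type*) where
  | gammaHalf : Gen ι
  | gammaHalfInv : Gen ι
  | d : Gen ι
  | k (i : ι) : Gen ι
  | kInv (i : ι) : Gen ι
  | a (i : ι) (n : {n : ℤ // n ≠ 0}) : Gen ι
  | x (ε : ℤˣ) (i : ι) (n : ℤ) : Gen ι

namespace Free

variable {ι : Type*}

/-- A generator in the free algebra. -/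
def gen (g : Gen ι) : FreeAlgebra ℂ (Gen ι) := FreeAlgebra.ι ℂ g

/-- `γ^{m/2}` for an integer `m`. -/
def gammaHalfPow (m : ℤ) : FreeAlgebra ℂ (Gen ι) :=
  gen Gen.gammaHalf ^ m.toNat * gen Gen.gammaHalfInv ^ (-m).toNat

/-- `a_i(n)` for `n ≠ 0`; there is no generator with `n = 0`, and the value there is `0`. -/
def a (i : ι) (n : ℤ) : FreeAlgebra ℂ (Gen ι) :=
  if hn : n ≠ 0 then gen (Gen.a i ⟨n, hn⟩) else 0

/-- `x_i^±(n)`. -/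
def x (ε : ℤˣ) (i : ι) (n : ℤ) : FreeAlgebra ℂ (Gen ι) := gen (Gen.x ε i n)

/-- `ψ_i(n)`, where `∑_{n ≥ 0} ψ_i(n) z^{-n} = k_i exp ((q - q^{-1}) ∑_{n > 0} a_i(n) z^{-n})` and
`ψ_i(n) = 0` for `n < 0`. -/
def psi (h : ℂ) (i : ι) (n : ℤ) : FreeAlgebra ℂ (Gen ι) :=
  if 0 ≤ n then
    gen (Gen.k i) * PowerSeries.coeff n.toNat
      (formalExp (PowerSeries.mk fun m : ℕ => (qpow h 1 - qpow h (-1)) • a i (m : ℤ)))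
  else 0

/-- `φ_i(n)`, where
`∑_{n ≥ 0} φ_i(-n) z^n = k_i^{-1} exp ((q^{-1} - q) ∑_{n > 0} a_i(-n) z^n)` and
`φ_i(n) = 0` for `n > 0`. -/
def phi (h : ℂ) (i : ι) (n : ℤ) : FreeAlgebra ℂ (Gen ι) :=
  if n ≤ 0 then
    gen (Gen.kInv i) * PowerSeries.coeff (-n).toNat
      (formalExp (PowerSeries.mk fun m : ℕ => (qpow h (-1) - qpow h 1) • a i (-(m : ℤ))))
  else 0

end Free

open Free in
/-- The defining relations, written in components with `x_i^±(z) = ∑ x_i^±(n) z^{-n}`. -/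
inductive Rel {ι : Type*} [Fintype ι] (C : CartanDatum ι) (h : ℂ) :
    FreeAlgebra ℂ (Gen ι) → FreeAlgebra ℂ (Gen ι) → Prop
  | gamma_mul_inv : Rel C h (gen Gen.gammaHalf * gen Gen.gammaHalfInv) 1
  | gamma_inv_mul : Rel C h (gen Gen.gammaHalfInv * gen Gen.gammaHalf) 1
  | gamma_central (g : Gen ι) :
      Rel C h (gen Gen.gammaHalf * gen g) (gen g * gen Gen.gammaHalf)
  | k_mul_inv (i : ι) : Rel C h (gen (Gen.k i) * gen (Gen.kInv i)) 1
  | k_inv_mul (i : ι) : Rel C h (gen (Gen.kInv i) * gen (Gen.k i)) 1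
  | k_k (i j : ι) : Rel C h (gen (Gen.k i) * gen (Gen.k j)) (gen (Gen.k j) * gen (Gen.k i))
  | k_d (i : ι) : Rel C h (gen (Gen.k i) * gen Gen.d) (gen Gen.d * gen (Gen.k i))
  | k_a (i j : ι) (n : ℤ) : Rel C h (gen (Gen.k i) * a j n) (a j n * gen (Gen.k i))
  | k_x (ε : ℤˣ) (i j : ι) (n : ℤ) :
      Rel C h (gen (Gen.k i) * x ε j n)
        (qpow h (((ε : ℤ) : ℚ) * C.form i j) • (x ε j n * gen (Gen.k i)))
  | d_a (i : ι) (n : ℤ) :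
      Rel C h (gen Gen.d * a i n - a i n * gen Gen.d) ((n : ℂ) • a i n)
  | d_x (ε : ℤˣ) (i : ι) (n : ℤ) :
      Rel C h (gen Gen.d * x ε i n - x ε i n * gen Gen.d) ((n : ℂ) • x ε i n)
  /- `[a_i(m), a_j(n)] = δ_{m,-n} [(α_i|α_j) m]/m (γ^m - γ^{-m})/(q - q^{-1})` -/
  | a_a (i j : ι) (m n : ℤ) (hm : m ≠ 0) (hn : n ≠ 0) :
      Rel C h (a i m * a j n - a j n * a i m)
        (if m = -n then
          (qnum h (C.form i j * m) / (m : ℂ) / (qpow h 1 - qpow h (-1))) •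
            (gammaHalfPow (2 * m) - gammaHalfPow (-(2 * m)))
        else 0)
  /- `[a_i(m), x_j^±(n)] = ± [(α_i|α_j) m]/m γ^{∓|m|/2} x_j^±(m + n)` -/
  | a_x (ε : ℤˣ) (i j : ι) (m n : ℤ) (hm : m ≠ 0) :
      Rel C h (a i m * x ε j n - x ε j n * a i m)
        ((((ε : ℤ) : ℂ) * (qnum h (C.form i j * m) / (m : ℂ))) •
          (gammaHalfPow (-((ε : ℤ) * |m|)) * x ε j (m + n)))
  /- `(z - q^{±(α_i|α_j)} w) x_i^±(z) x_j^±(w) = (q^{±(α_i|α_j)} z - w) x_j^±(w) x_i^±(z)` -/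
  | x_x (ε : ℤˣ) (i j : ι) (m n : ℤ) :
      Rel C h
        (x ε i (m + 1) * x ε j n
          - qpow h (((ε : ℤ) : ℚ) * C.form i j) • (x ε i m * x ε j (n + 1)))
        (qpow h (((ε : ℤ) : ℚ) * C.form i j) • (x ε j n * x ε i (m + 1))
          - x ε j (n + 1) * x ε i m)
  /- `[x_i^+(z), x_j^-(w)] = δ_{ij}/(q_i - q_i^{-1})
    (δ(γ^{-1} z/w) ψ_i(γ^{1/2} w) - δ(γ z/w) φ_i(γ^{1/2} z))` -/
  | x_plus_minus (i : ι) (m n : ℤ) :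
      Rel C h (x 1 i m * x (-1) i n - x (-1) i n * x 1 i m)
        ((qpow h (C.d i) - qpow h (-C.d i))⁻¹ •
          (gammaHalfPow (m - n) * psi h i (m + n) - gammaHalfPow (n - m) * phi h i (m + n)))
  | x_plus_minus_of_ne (i j : ι) (hij : i ≠ j) (m n : ℤ) :
      Rel C h (x 1 i m * x (-1) j n - x (-1) j n * x 1 i m) 0
  /- the Serre relations, with `N = 1 - A_{ij}` -/
  | serre (ε : ℤˣ) (i j : ι) (hij : i ≠ j) (n : Fin (1 - C.A i j).toNat → ℤ) (m : ℤ) :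
      Rel C h
        (∑ σ : Equiv.Perm (Fin (1 - C.A i j).toNat),
          ∑ s ∈ Finset.range ((1 - C.A i j).toNat + 1),
            ((-1 : ℂ) ^ s * qbinomial h (C.d i) (1 - C.A i j).toNat s) •
              (((List.ofFn fun t => x ε i (n (σ t))).take s).prod * x ε j m *
                ((List.ofFn fun t => x ε i (n (σ t))).drop s).prod))
        0

/-- The quantum affine algebra `U_q(ĝ)` over `ℂ`. -/
def Uq {ι : Type*} [Fintype ι] (C : CartanDatum ι) (h : ℂ) : Type _ := RingQuot (Rel C h)

instance {ι : Type*} [Fintype ι] (C : CartanDatum ι) (h : ℂ) : Ring (Uq C h) :=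
  inferInstanceAs (Ring (RingQuot (Rel C h)))

instance {ι : Type*} [Fintype ι] (C : CartanDatum ι) (h : ℂ) : Algebra ℂ (Uq C h) :=
  inferInstanceAs (Algebra ℂ (RingQuot (Rel C h)))

namespace Uq

variable {ι : Type*} [Fintype ι] (C : CartanDatum ι) (h : ℂ)

/-- The projection from the free algebra. -/
def mk : FreeAlgebra ℂ (Gen ι) →ₐ[ℂ] Uq C h := RingQuot.mkAlgHom ℂ (Rel C h)

def gammaHalf : Uq C h := mk C h (Free.gen Gen.gammaHalf)

def d : Uq C h := mk C h (Free.gen Gen.d)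

def k (i : ι) : Uq C h := mk C h (Free.gen (Gen.k i))

def kInv (i : ι) : Uq C h := mk C h (Free.gen (Gen.kInv i))

def a (i : ι) (n : ℤ) : Uq C h := mk C h (Free.a i n)

def x (ε : ℤˣ) (i : ι) (n : ℤ) : Uq C h := mk C h (Free.x ε i n)

end Uq

/-! ## Modules of level `k` -/

section Modules

variable {ι : Type*} [Fintype ι] (C : CartanDatum ι) (h : ℂ) (κ : ℚ)
variable (V : Type*) [AddCommGroup V] [Module ℂ V] [Module (Uq C h) V] [IsScalarTower ℂ (Uq C h) V]

/-- The homogeneous subspace `V_c = {v | d v = c v}`. -/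
def homogeneous (c : ℂ) : Submodule ℂ V :=
  Module.End.eigenspace (Algebra.lsmul ℂ ℂ V (Uq.d C h)) c

/-- Modules of level `κ` (`γ = q^c` acts as `q^κ`, and accordingly `γ^{1/2} = q^{c/2}` as `q^{κ/2}`),
spanned by their homogeneous subspaces, with degrees bounded above on each coset of `ℤ`. Weight
spaces may be infinite-dimensional. -/
structure IsLevelModule : Prop where
  level : ∀ v : V, Uq.gammaHalf C h • v = qpow h (κ / 2) • v
  graded : ⨆ c : ℂ, homogeneous C h V c = ⊤
  bounded : ∀ c : ℂ, ∃ n₀ : ℕ, ∀ n : ℕ, n₀ < n → homogeneous C h V (c + n) = ⊥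

/-! ## `Z`-vertex operators -/

/-- `E_-^±(α_i, z) = exp (∓ ∑_{n ≥ 1} q^{∓κn/2} / [κn] a_i(-n) z^n)`, a power series in `z`. -/
def EMinus (ε : ℤˣ) (i : ι) : (Uq C h)⟦X⟧ :=
  formalExp (PowerSeries.mk fun n : ℕ =>
    (-((ε : ℤ) : ℂ) * (qpow h (-(((ε : ℤ) : ℚ) * κ * n / 2)) / qnum h (κ * n))) •
      Uq.a C h i (-(n : ℤ)))

/-- `E_+^±(α_i, z) = exp (± ∑_{n ≥ 1} q^{∓κn/2} / [κn] a_i(n) z^{-n})`, a power series in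
`z^{-1}`. -/
def EPlus (ε : ℤˣ) (i : ι) : (Uq C h)⟦X⟧ :=
  formalExp (PowerSeries.mk fun n : ℕ =>
    (((ε : ℤ) : ℂ) * (qpow h (-(((ε : ℤ) : ℚ) * κ * n / 2)) / qnum h (κ * n))) •
      Uq.a C h i (n : ℤ))

variable {V}

/-- The terms whose sum over `(r, s)` is the coefficient of `z^{-n}` in
`E_-^±(α_i, z) x_i^±(z) E_+^±(α_i, z) v`, where `x_i^±(z) = ∑ x_i^±(n) z^{-n}`. -/
def zTerm (ε : ℤˣ) (i : ι) (n : ℤ) (v : V) (p : ℕ × ℕ) : V :=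
  PowerSeries.coeff p.1 (EMinus C h κ ε i) •
    Uq.x C h ε i (n + p.1 - p.2) • PowerSeries.coeff p.2 (EPlus C h κ ε i) • v

/-- `Z ε i n` are the components of `Z^±(α_i, z) = E_-^±(α_i, z) x_i^±(z) E_+^±(α_i, z)`, i.e.
`Z^±(α_i, z) = ∑ Z^±_i(n) z^{-n}`: on each vector the product is a sum with finitely many nonzero
terms in every degree, and `Z ε i n` is that sum. -/
def IsZOperator (Z : ℤˣ → ι → ℤ → Module.End ℂ V) : Prop :=
  ∀ (ε : ℤˣ) (i : ι) (n : ℤ) (v : V),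
    (Function.support (zTerm C h κ ε i n v)).Finite ∧
      Z ε i n v = ∑ᶠ p : ℕ × ℕ, zTerm C h κ ε i n v p

end Modules

/-! ## Formal series in `z^{±1}`, `w^{±1}`

A function `F : ℤ → ℤ → V` stands for the formal series `∑ F a b z^a w^b`. -/

section Series

variable {V : Type*} [AddCommGroup V] [Module ℂ V]

/-- `(c₁ z - c₂ w) F(z, w)`. -/
def mulLinear (c₁ c₂ : ℂ) (F : ℤ → ℤ → V) (a b : ℤ) : V :=
  c₁ • F (a - 1) b - c₂ • F a (b - 1)

/-- `P(w/z) F(z, w)`. -/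
def mulSeriesWZ (P : ℂ⟦X⟧) (F : ℤ → ℤ → V) (a b : ℤ) : V :=
  ∑ᶠ r : ℕ, PowerSeries.coeff r P • F (a + r) (b - r)

/-- `P(z/w) F(z, w)`. -/
def mulSeriesZW (P : ℂ⟦X⟧) (F : ℤ → ℤ → V) (a b : ℤ) : V :=
  ∑ᶠ r : ℕ, PowerSeries.coeff r P • F (a - r) (b + r)

/-- The coefficients of `δ(c z/w) = ∑_{n ∈ ℤ} c^n z^n w^{-n}`. -/
def delta (c : ℂ) (a b : ℤ) : ℂ := if b = -a then c ^ a else 0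

/-- `X(z) Y(w) v` for `X(z) = ∑ X(n) z^{-n}`, `Y(w) = ∑ Y(n) w^{-n}`. -/
def prodZW (X Y : ℤ → Module.End ℂ V) (v : V) (a b : ℤ) : V := X (-a) (Y (-b) v)

/-- `Y(w) X(z) v` for `X(z) = ∑ X(n) z^{-n}`, `Y(w) = ∑ Y(n) w^{-n}`. -/
def prodWZ (Y X : ℤ → Module.End ℂ V) (v : V) (a b : ℤ) : V := Y (-b) (X (-a) v)

/-- Operators `Z^±_i(n)` and `K_i^{±1}` on `V` satisfying the defining relations of the homogeneous
quantum `Z`-algebra of level `κ`, for `Z^±(α_i, z) = ∑ Z^±_i(n) z^{-n}`. By the first condition all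
sums in the relations, applied to a vector, have finitely many nonzero terms in every degree. -/
structure QuantumZRelations {ι : Type*} [Fintype ι] [DecidableEq ι] (C : CartanDatum ι) (h : ℂ)
    (κ : ℚ) (K KInv : ι → Module.End ℂ V) (Z : ℤˣ → ι → ℤ → Module.End ℂ V) : Prop where
  truncated : ∀ (ε : ℤˣ) (i : ι) (v : V), ∃ N : ℤ, ∀ n : ℤ, N < n → Z ε i n v = 0
  /-- `(1 - q^{∓κ} w/z)^{(α_i|α_j)/κ} (z - q^{±(α_i|α_j)} w) Z^±(α_i, z) Z^±(α_j, w)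
    = (1 - q^{∓κ} z/w)^{(α_i|α_j)/κ} (q^{±(α_i|α_j)} z - w) Z^±(α_j, w) Z^±(α_i, z)` -/
  same_sign : ∀ (ε : ℤˣ) (i j : ι) (v : V),
    mulSeriesWZ
        (PowerSeries.rescale (qpow h (-(((ε : ℤ) : ℚ) * κ))) (qPochhammerPow h κ (C.form i j)))
        (mulLinear 1 (qpow h (((ε : ℤ) : ℚ) * C.form i j)) (prodZW (Z ε i) (Z ε j) v))
      = mulSeriesZW
        (PowerSeries.rescale (qpow h (-(((ε : ℤ) : ℚ) * κ))) (qPochhammerPow h κ (C.form i j)))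
        (mulLinear (qpow h (((ε : ℤ) : ℚ) * C.form i j)) 1 (prodWZ (Z ε j) (Z ε i) v))
  /-- `(1 - w/z)^{-(α_i|α_j)/κ} Z^+(α_i, z) Z^-(α_j, w)
      - (1 - z/w)^{-(α_i|α_j)/κ} Z^-(α_j, w) Z^+(α_i, z)
    = δ_{ij} / (q_i - q_i^{-1}) (K_i δ(q^{-κ} z/w) - K_i^{-1} δ(q^κ z/w))` -/
  mixed_sign : ∀ (i j : ι) (v : V) (a b : ℤ),
    mulSeriesWZ (qPochhammerPow h κ (-C.form i j)) (prodZW (Z 1 i) (Z (-1) j) v) a b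
        - mulSeriesZW (qPochhammerPow h κ (-C.form i j)) (prodWZ (Z (-1) j) (Z 1 i) v) a b
      = if i = j then
          (qpow h (C.d i) - qpow h (-C.d i))⁻¹ •
            (delta (qpow h (-κ)) a b • K i v - delta (qpow h κ) a b • KInv i v)
        else 0

end Series

end QuantumZ

end

/-!
The negative and positive halves of the Heisenberg algebra dress a field `x(z)` to
`E_-(z) x(z) E_+(z)`. The exponent of `E_-` is chosen so that the dressed field `Z(w)` commutes with
all `a_i(m)`, `m > 0`, hence with `E_+(z)`, whereas moving `E_-(w)` past `x(z)` costs the scalar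
series `(1 - u)_{q^{2k}}^{±a/k}` at a multiple `u` of `w/z`. Therefore this series times `Z(z) Z(w)`
is the normally ordered dressing `E_-(z) E_-(w) x(z) x(w) E_+(w) E_+(z)`, which is symmetric in the
two dressings, and the relations between the `x_i^±` carry over. In the mixed relation the dressing
meets `ψ_i` and `φ_i` only on the supports of `δ(q^{∓k} z/w)`, where it cancels their exponentials
and leaves `k_i^{±1}`.
-/

noncomputable section

namespace QuantumZ

/-! ## Formal exponentials -/

section FormalExp

open Finset

variable {A : Type*} [Ring A]

/-- Every coefficient of `f` commutes with every coefficient of `g`; stronger than `Commute f g`. -/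
def CoeffCommute (f g : A⟦X⟧) : Prop := ∀ m n, Commute (coeff m f) (coeff n g)

theorem CoeffCommute.symm {f g : A⟦X⟧} (hfg : CoeffCommute f g) : CoeffCommute g f :=
  fun m n => (hfg n m).symm

theorem CoeffCommute.commute {f g : A⟦X⟧} (hfg : CoeffCommute f g) : Commute f g := by
  ext n
  rw [coeff_mul, coeff_mul, ← Finset.Nat.sum_antidiagonal_swap]
  exact Finset.sum_congr rfl fun p _ => hfg _ _

theorem coeff_pow_eq_zero {f : A⟦X⟧} (hf : constantCoeff f = 0) {n r : ℕ} (hn : n < r) :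
    coeff n (f ^ r) = 0 := by
  obtain ⟨g, rfl⟩ : ∃ g, f = X * g := X_dvd_iff.mpr hf
  rw [((commute_X g).symm).mul_pow, coeff_X_pow_mul', if_neg hn.not_ge]

variable [Algebra ℂ A]

theorem coeff_mul_mem (D : ℕ → Submodule ℂ A) [SetLike.GradedMonoid D] {f g : A⟦X⟧}
    (hf : ∀ n, coeff n f ∈ D n) (hg : ∀ n, coeff n g ∈ D n) (n : ℕ) : coeff n (f * g) ∈ D n := by
  rw [coeff_mul]
  exact sum_mem fun p hp => mem_antidiagonal.mp hp ▸ SetLike.GradedMul.mul_mem (hf p.1) (hg p.2)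

theorem coeff_formalExp_mem (D : ℕ → Submodule ℂ A) [SetLike.GradedMonoid D] {f : A⟦X⟧}
    (hf : ∀ n, coeff n f ∈ D n) (n : ℕ) : coeff n (formalExp f) ∈ D n := by
  have coeff_pow_mem (r : ℕ) : ∀ n, coeff n (f ^ r) ∈ D n := by
    induction r with
    | zero =>
      intro n
      rw [pow_zero, coeff_one]
      split_ifs with hn
      · exact hn ▸ SetLike.GradedOne.one_mem
      · exact zero_mem _
    | succ r ih => exact pow_succ f r ▸ coeff_mul_mem D ih hf
  rw [formalExp, coeff_mk]
  exact sum_mem fun r _ => Submodule.smul_mem _ _ (coeff_pow_mem r n)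

theorem commute_coeff_formalExp {y : A} {f : A⟦X⟧} (hy : ∀ n, Commute y (coeff n f)) (n : ℕ) :
    Commute y (coeff n (formalExp f)) := by
  let S : Subalgebra ℂ A := Subalgebra.centralizer ℂ {y}
  have mem_S {a : A} : a ∈ S ↔ Commute y a := by
    simp [S, Subalgebra.mem_centralizer_iff, Commute, SemiconjBy]
  have : SetLike.GradedMonoid fun _ : ℕ => Subalgebra.toSubmodule S :=
    { one_mem := S.one_mem, mul_mem := fun _ _ _ _ ha hb => S.mul_mem ha hb }
  exact mem_S.mp (coeff_formalExp_mem (fun _ => Subalgebra.toSubmodule S)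
    (fun n => mem_S.mpr (hy n)) n)

theorem CoeffCommute.formalExp_right {f g : A⟦X⟧} (hfg : CoeffCommute f g) :
    CoeffCommute f (formalExp g) :=
  fun m => commute_coeff_formalExp (hfg m)

theorem CoeffCommute.formalExp {f g : A⟦X⟧} (hfg : CoeffCommute f g) :
    CoeffCommute (formalExp f) (formalExp g) :=
  hfg.formalExp_right.symm.formalExp_right.symm

/-- The Euler operator `X d/dX` on power series over a possibly noncommutative algebra. -/
def euler : A⟦X⟧ →ₗ[ℂ] A⟦X⟧ where
  toFun f := PowerSeries.mk fun n => (n : ℂ) • coeff n f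
  map_add' f g := by ext n; simp
  map_smul' c f := by ext n; simp [smul_comm c]

@[simp]
theorem coeff_euler (n : ℕ) (f : A⟦X⟧) : coeff n (euler f) = (n : ℂ) • coeff n f := by
  simp [euler]

@[simp]
theorem constantCoeff_euler (f : A⟦X⟧) : constantCoeff (euler f) = 0 := by
  rw [← coeff_zero_eq_constantCoeff_apply, coeff_euler, Nat.cast_zero, zero_smul]

@[simp]
theorem euler_C (y : A) : euler (PowerSeries.C y) = 0 := by
  ext n
  rcases eq_or_ne n 0 with rfl | hn
  · simp
  · simp [coeff_C, hn]

theorem euler_mul (f g : A⟦X⟧) : euler (f * g) = euler f * g + f * euler g := by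
  ext n
  simp only [coeff_euler, coeff_mul, map_add, Finset.smul_sum, ← Finset.sum_add_distrib]
  refine Finset.sum_congr rfl fun p hp => ?_
  rw [← mem_antidiagonal.mp hp, smul_mul_assoc, mul_smul_comm, ← add_smul, Nat.cast_add]

theorem CoeffCommute.euler_right {f g : A⟦X⟧} (hfg : CoeffCommute f g) :
    CoeffCommute f (euler g) := fun m n => by
  rw [coeff_euler]
  exact (hfg m n).smul_right _

theorem eq_of_euler_eq_mul {F g g' : A⟦X⟧} (hF : constantCoeff F = 0) (hg : euler g = F * g)
    (hg' : euler g' = F * g') (h0 : constantCoeff g = constantCoeff g') : g = g' := by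
  ext n
  induction n using Nat.strong_induction_on with
  | _ n ih =>
    rcases Nat.eq_zero_or_pos n with rfl | hn
    · simpa using h0
    refine smul_right_injective A (Nat.cast_ne_zero.mpr hn.ne' : (n : ℂ) ≠ 0) ?_
    simp only
    rw [← coeff_euler, ← coeff_euler, hg, hg', coeff_mul, coeff_mul]
    refine Finset.sum_congr rfl fun p hp => ?_
    have hp : p.1 + p.2 = n := mem_antidiagonal.mp hp
    rcases Nat.eq_zero_or_pos p.1 with h1 | h1
    · simp [h1, hF]
    · rw [ih p.2 (by omega)]

theorem euler_pow_succ {f : A⟦X⟧} (hf : CoeffCommute f f) (r : ℕ) :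
    euler (f ^ (r + 1)) = ((r + 1 : ℕ) : ℂ) • (euler f * f ^ r) := by
  induction r with
  | zero => simp
  | succ r ih =>
    rw [pow_succ' f (r + 1), euler_mul, ih, mul_smul_comm, ← mul_assoc f,
      hf.euler_right.commute.eq, mul_assoc, ← pow_succ']
    push_cast
    module

theorem coeff_formalExp_eq_sum_range {f : A⟦X⟧} (hf : constantCoeff f = 0) {n N : ℕ} (hn : n < N) :
    coeff n (formalExp f) = coeff n (∑ r ∈ range N, ((r.factorial : ℂ)⁻¹) • f ^ r) := by
  rw [formalExp, coeff_mk, map_sum]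
  refine Finset.sum_subset (by simpa using hn) fun r _ hr => ?_
  rw [coeff_pow_eq_zero hf (by simpa using hr), smul_zero]

@[simp]
theorem constantCoeff_formalExp (f : A⟦X⟧) : constantCoeff (formalExp f) = 1 := by
  rw [← coeff_zero_eq_constantCoeff_apply, formalExp, coeff_mk]
  simp

theorem euler_sum_range_pow {f : A⟦X⟧} (hf : CoeffCommute f f) (N : ℕ) :
    euler (∑ r ∈ range (N + 1), ((r.factorial : ℂ)⁻¹) • f ^ r)
      = euler f * ∑ r ∈ range N, ((r.factorial : ℂ)⁻¹) • f ^ r := by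
  have euler_one : euler (1 : A⟦X⟧) = 0 := euler_C 1
  rw [Finset.sum_range_succ', map_add, map_sum, Finset.mul_sum, map_smul, pow_zero, euler_one,
    smul_zero, add_zero]
  refine Finset.sum_congr rfl fun r _ => ?_
  have hr : ((r + 1 : ℕ) : ℂ) ≠ 0 := Nat.cast_ne_zero.mpr r.succ_ne_zero
  rw [map_smul, euler_pow_succ hf, mul_smul_comm, smul_smul, Nat.factorial_succ, Nat.cast_mul,
    mul_inv, mul_right_comm, inv_mul_cancel₀ hr, one_mul]

theorem euler_formalExp {f : A⟦X⟧} (h0 : constantCoeff f = 0) (hf : CoeffCommute f f) :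
    euler (formalExp f) = euler f * formalExp f := by
  ext n
  rw [coeff_euler, coeff_formalExp_eq_sum_range h0 (show n < n + 1 + 1 by omega), ← coeff_euler,
    euler_sum_range_pow hf, coeff_mul, coeff_mul]
  refine Finset.sum_congr rfl fun p hp => ?_
  rw [coeff_formalExp_eq_sum_range h0 (Finset.Nat.antidiagonal.snd_lt hp)]

theorem formalExp_add {f g : A⟦X⟧} (hf0 : constantCoeff f = 0) (hg0 : constantCoeff g = 0)
    (hf : CoeffCommute f f) (hg : CoeffCommute g g) (hfg : CoeffCommute f g) :
    formalExp (f + g) = formalExp f * formalExp g := by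
  have hfg0 : constantCoeff (f + g) = 0 := by rw [map_add, hf0, hg0, add_zero]
  have hadd : CoeffCommute (f + g) (f + g) := fun m n => by
    simp only [map_add]
    exact ((hf m n).add_right (hfg m n)).add_left ((hfg.symm m n).add_right (hg m n))
  have hcomm : Commute (formalExp f) (euler g) :=
    hfg.symm.formalExp_right.symm.euler_right.commute
  refine eq_of_euler_eq_mul (by simp) (euler_formalExp hfg0 hadd) ?_ (by simp)
  rw [euler_mul, euler_formalExp hf0 hf, euler_formalExp hg0 hg, map_add, add_mul, mul_assoc,
    ← mul_assoc (formalExp f), hcomm.eq, mul_assoc]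

@[simp]
theorem formalExp_zero : formalExp (0 : A⟦X⟧) = 1 :=
  eq_of_euler_eq_mul (F := 0) (map_zero _)
    (by rw [euler_formalExp (map_zero _) (fun _ _ => Commute.zero_left _), map_zero])
    (by rw [zero_mul]; exact euler_C 1) (by simp)

theorem map_formalExp {A' : Type*} [Ring A'] [Algebra ℂ A'] (φ : A →ₐ[ℂ] A') (f : A⟦X⟧) :
    PowerSeries.map (φ : A →+* A') (formalExp f)
      = formalExp (PowerSeries.map (φ : A →+* A') f) := by
  ext n
  simp [formalExp, ← map_pow]

/-- The substitution `X ↦ cX` on power series over a possibly noncommutative algebra. -/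
def scaleX (c : ℂ) : A⟦X⟧ →+* A⟦X⟧ where
  toFun f := PowerSeries.mk fun n => c ^ n • coeff n f
  map_one' := by
    ext n
    rcases eq_or_ne n 0 with rfl | hn
    · simp
    · simp [coeff_one, hn]
  map_mul' f g := by
    ext n
    simp only [coeff_mk, coeff_mul, Finset.smul_sum]
    refine Finset.sum_congr rfl fun p hp => ?_
    rw [← mem_antidiagonal.mp hp, pow_add, smul_mul_smul_comm]
  map_zero' := by ext n; simp
  map_add' f g := by ext n; simp

@[simp]
theorem coeff_scaleX (c : ℂ) (f : A⟦X⟧) (n : ℕ) : coeff n (scaleX c f) = c ^ n • coeff n f := by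
  simp [scaleX]

theorem scaleX_formalExp (c : ℂ) (f : A⟦X⟧) : scaleX c (formalExp f) = formalExp (scaleX c f) := by
  ext n
  simp only [coeff_scaleX, formalExp, coeff_mk, Finset.smul_sum, ← map_pow]
  exact Finset.sum_congr rfl fun r _ => smul_comm _ _ _

theorem rescale_formalExp (c : ℂ) (f : ℂ⟦X⟧) :
    PowerSeries.rescale c (formalExp f) = formalExp (PowerSeries.rescale c f) := by
  have rescale_eq (g : ℂ⟦X⟧) : PowerSeries.rescale c g = scaleX c g := by ext n; simp
  rw [rescale_eq, rescale_eq, scaleX_formalExp]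

theorem mul_formalExp_of_bracket {f M : A⟦X⟧} {y : A} (h0 : constantCoeff f = 0)
    (hf : CoeffCommute f f) (hM : CoeffCommute M f)
    (hy : PowerSeries.C y * f = f * PowerSeries.C y + M) :
    PowerSeries.C y * formalExp f = formalExp f * PowerSeries.C y + M * formalExp f := by
  have hM0 : constantCoeff M = 0 := by simpa [h0] using (congrArg constantCoeff hy).symm
  have hMe : M * euler f = euler f * M := hM.euler_right.commute
  have hye : PowerSeries.C y * euler f = euler f * PowerSeries.C y + euler M := by
    simpa [euler_mul] using congrArg euler hy
  rw [← sub_eq_zero, ← sub_sub]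
  refine eq_of_euler_eq_mul (F := euler f) (by simp) ?_ (by simp) ?_
  · simp only [map_sub, euler_mul, euler_C, euler_formalExp h0 hf, zero_mul, mul_zero]
    simp only [← mul_assoc, hye, hMe]
    noncomm_ring
  · simp [hM0]

/-- In generating functions: `exp(f)(w) x(z) = exp(l)(w/z) x(z) exp(f)(w)`, where
`x(z) = ∑ x(p) z^{-p}`. -/
theorem formalExp_mul_C_field {f : A⟦X⟧} (h0 : constantCoeff f = 0) (hf : CoeffCommute f f)
    {l : ℂ⟦X⟧} (hl : constantCoeff l = 0) {x : ℤ → A}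
    (hx : ∀ (j : ℕ) (p : ℤ), coeff j f * x p = x p * coeff j f + coeff j l • x (p - j)) (p : ℤ) :
    formalExp f * PowerSeries.C (x p)
      = (PowerSeries.mk fun r : ℕ => coeff r (formalExp l) • x (p - r)) * formalExp f := by
  set T : A⟦X⟧ := PowerSeries.mk fun r : ℕ => coeff r (formalExp l) • x (p - r) with hT
  have hfT : euler f * T = T * euler f + euler T := by
    ext n
    have hTf : coeff n (T * euler f) = ∑ q ∈ antidiagonal n, coeff q.2 T * coeff q.1 (euler f) := by
      rw [coeff_mul, ← Finset.Nat.sum_antidiagonal_swap]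
      rfl
    have hT' : coeff n (euler T)
        = ∑ q ∈ antidiagonal n, (coeff q.1 (euler l) * coeff q.2 (formalExp l)) • x (p - n) := by
      rw [← Finset.sum_smul, ← coeff_mul, ← euler_formalExp hl fun _ _ => Commute.all _ _]
      simp [hT, mul_smul]
    rw [map_add, hTf, hT', coeff_mul, ← Finset.sum_add_distrib]
    refine Finset.sum_congr rfl fun q hq => ?_
    rw [← mem_antidiagonal.mp hq]
    simp only [hT, coeff_mk, coeff_euler, smul_mul_assoc, mul_smul_comm, hx, smul_add, smul_smul,
      smul_eq_mul, Nat.cast_add, sub_sub, add_comm (q.2 : ℤ)]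
    module
  refine eq_of_euler_eq_mul (F := euler f) (by simp) ?_ ?_ ?_
  · rw [euler_mul, euler_C, euler_formalExp h0 hf, mul_zero, add_zero, mul_assoc]
  · rw [euler_mul, euler_formalExp h0 hf, ← mul_assoc, ← mul_assoc, hfT]
    noncomm_ring
  · rw [← coeff_zero_eq_constantCoeff_apply, ← coeff_zero_eq_constantCoeff_apply]
    simp [hT, coeff_mul]

end FormalExp

/-! ## Pointwise finite sums of operators -/

section PointwiseSum

open Function

theorem finsum_eq_finsum_sum_fiber {M α β : Type*} [AddCommMonoid M] {f : α → M}
    (hf : f.HasFiniteSupport) {g : α → β} {t : β → Finset α} (ht : ∀ a b, a ∈ t b ↔ g a = b) :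
    ∑ᶠ a, f a = ∑ᶠ b, ∑ a ∈ t b, f a := by
  classical
  replace hf : (support f).Finite := hf
  have fiber_subset (b : β) : {a ∈ hf.toFinset | g a = b} ⊆ t b := fun a ha =>
    (ht a b).mpr (Finset.mem_filter.mp ha).2
  have sum_fiber (b : β) : ∑ a ∈ hf.toFinset with g a = b, f a = ∑ a ∈ t b, f a :=
    Finset.sum_subset (fiber_subset b) fun a ha ha' => by
      simpa [(ht a b).mp ha] using ha'
  rw [finsum_eq_sum_of_support_subset f (s := hf.toFinset) (by simp),
    finsum_eq_sum_of_support_subset _ (s := hf.toFinset.image g),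
    ← Finset.sum_fiberwise_of_maps_to fun a ha => Finset.mem_image_of_mem g ha]
  · exact Finset.sum_congr rfl fun b _ => sum_fiber b
  · intro b hb
    obtain ⟨a, ha, hfa⟩ := Finset.exists_ne_zero_of_sum_ne_zero (mem_support.mp hb)
    simpa using ⟨a, hfa, (ht a b).mp ha⟩

variable {R M α β : Type*} [CommRing R] [AddCommGroup M] [Module R M]

/-- A family of operators only finitely many of which are nonzero on any given vector. -/
def PointwiseFinite (T : α → Module.End R M) : Prop := ∀ v, (fun a => T a v).HasFiniteSupport

open Classical in
/-- The sum of a pointwise finite family of operators; `0` for any other family. -/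
def pointwiseSum (T : α → Module.End R M) : Module.End R M :=
  if hT : PointwiseFinite T then
    { toFun v := ∑ᶠ a, T a v
      map_add' v w := by simp only [map_add, finsum_add_distrib (hT v) (hT w)]
      map_smul' c v := by simp only [map_smul, RingHom.id_apply, smul_finsum' c (hT v)] }
  else 0

theorem pointwiseSum_apply {T : α → Module.End R M} (hT : PointwiseFinite T) (v : M) :
    pointwiseSum T v = ∑ᶠ a, T a v := by
  rw [pointwiseSum, dif_pos hT]
  rfl

namespace PointwiseFinite

variable {T : α → Module.End R M}

theorem mul_left (hT : PointwiseFinite T) (y : Module.End R M) :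
    PointwiseFinite fun a => y * T a :=
  fun v => (hT v).subset fun a ha h => ha (by simp [show T a v = 0 from h])

theorem mul_right (hT : PointwiseFinite T) (y : Module.End R M) :
    PointwiseFinite fun a => T a * y := fun v => hT (y v)

theorem smul (hT : PointwiseFinite T) (c : α → R) : PointwiseFinite fun a => c a • T a :=
  fun v => (hT v).subset fun a ha h => ha (by simp [show T a v = 0 from h])

theorem curry_right {T : α × β → Module.End R M} (hT : PointwiseFinite T) (a : α) :
    PointwiseFinite fun b => T (a, b) :=
  fun v => (hT v).comp_of_injective (Prod.mk_right_injective a)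

theorem comp_equiv (hT : PointwiseFinite T) (e : β ≃ α) : PointwiseFinite fun b => T (e b) :=
  fun v => (hT v).comp_of_injective e.injective

theorem fiber (hT : PointwiseFinite T) {g : α → β} {t : β → Finset α}
    (ht : ∀ a b, a ∈ t b ↔ g a = b) : PointwiseFinite fun b => ∑ a ∈ t b, T a := fun v =>
  ((hT v).image g).subset fun b hb => by
    simp only [LinearMap.sum_apply, mem_support] at hb
    obtain ⟨a, ha, hTa⟩ := Finset.exists_ne_zero_of_sum_ne_zero hb
    exact ⟨a, hTa, (ht a b).mp ha⟩

end PointwiseFinite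

theorem pointwiseSum_eq_single {T : α → Module.End R M} (a : α) (hT : ∀ b, b ≠ a → T b = 0) :
    pointwiseSum T = T a := by
  have hfin : PointwiseFinite T := fun v => (Set.finite_singleton a).subset fun b hb => by
    by_contra hba
    exact hb (by simp [hT b hba])
  ext v
  rw [pointwiseSum_apply hfin, finsum_eq_single _ a fun b hb => by simp [hT b hb]]

theorem mul_pointwiseSum {T : α → Module.End R M} (hT : PointwiseFinite T) (y : Module.End R M) :
    y * pointwiseSum T = pointwiseSum fun a => y * T a := by
  ext v
  rw [Module.End.mul_apply, pointwiseSum_apply hT, map_finsum y (hT v),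
    pointwiseSum_apply (hT.mul_left y)]
  rfl

theorem pointwiseSum_mul {T : α → Module.End R M} (hT : PointwiseFinite T) (y : Module.End R M) :
    pointwiseSum T * y = pointwiseSum fun a => T a * y := by
  ext v
  rw [Module.End.mul_apply, pointwiseSum_apply hT, pointwiseSum_apply (hT.mul_right y)]
  rfl

theorem smul_pointwiseSum {T : α → Module.End R M} (hT : PointwiseFinite T) (c : R) :
    c • pointwiseSum T = pointwiseSum fun a => c • T a := by
  ext v
  rw [LinearMap.smul_apply, pointwiseSum_apply hT, smul_finsum' c (hT v),
    pointwiseSum_apply (hT.smul fun _ => c)]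
  rfl

theorem pointwiseSum_sub {S T : α → Module.End R M} (hS : PointwiseFinite S)
    (hT : PointwiseFinite T) :
    pointwiseSum (fun a => S a - T a) = pointwiseSum S - pointwiseSum T := by
  ext v
  have hST : PointwiseFinite fun a => S a - T a := fun w => (hS w).sub (hT w)
  rw [LinearMap.sub_apply, pointwiseSum_apply hS, pointwiseSum_apply hT, pointwiseSum_apply hST,
    ← finsum_sub_distrib (hS v) (hT v)]
  rfl

theorem pointwiseSum_curry {T : α × β → Module.End R M} (hT : PointwiseFinite T) :
    pointwiseSum T = pointwiseSum fun a => pointwiseSum fun b => T (a, b) := by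
  ext v
  have curry_apply (w : M) (a : α) : pointwiseSum (fun b => T (a, b)) w = ∑ᶠ b, T (a, b) w :=
    pointwiseSum_apply (hT.curry_right a) w
  have hT' : PointwiseFinite fun a => pointwiseSum fun b => T (a, b) := fun w =>
    ((hT w).image Prod.fst).subset fun a ha => by
      by_contra! hTa
      exact ha ((curry_apply w a).trans (finsum_eq_zero_of_forall_eq_zero fun b => by
        by_contra hb
        exact hTa ⟨(a, b), hb, rfl⟩))
  simp only [pointwiseSum_apply hT, pointwiseSum_apply hT', curry_apply, finsum_curry _ (hT v)]

theorem pointwiseSum_comp_equiv (e : α ≃ β) (T : β → Module.End R M) :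
    pointwiseSum (fun a => T (e a)) = pointwiseSum T := by
  have finite_iff : PointwiseFinite (fun a => T (e a)) ↔ PointwiseFinite T :=
    ⟨fun hT => by simpa using hT.comp_equiv e.symm, fun hT => hT.comp_equiv e⟩
  by_cases hT : PointwiseFinite T
  · ext v
    rw [pointwiseSum_apply hT, pointwiseSum_apply (finite_iff.mpr hT)]
    exact finsum_comp_equiv e (f := fun b => T b v)
  · rw [pointwiseSum, pointwiseSum, dif_neg hT, dif_neg (mt finite_iff.mp hT)]

theorem pointwiseSum_fiber {T : α → Module.End R M} (hT : PointwiseFinite T) {g : α → β}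
    {t : β → Finset α} (ht : ∀ a b, a ∈ t b ↔ g a = b) :
    pointwiseSum (fun b => ∑ a ∈ t b, T a) = pointwiseSum T := by
  ext v
  rw [pointwiseSum_apply hT, pointwiseSum_apply (hT.fiber ht), finsum_eq_finsum_sum_fiber (hT v) ht]
  simp only [LinearMap.sum_apply]

end PointwiseSum

/-! ## Operators of given degree -/

section Degree

variable {V : Type*} [AddCommGroup V] [Module ℂ V] (d : Module.End ℂ V)

/-- The operators `T` with `[d, T] = n T`. -/
def degPart (n : ℤ) : Submodule ℂ (Module.End ℂ V) where
  carrier := {T | d * T = T * d + (n : ℂ) • T}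
  add_mem' {S T} hS hT := by
    simp only [Set.mem_ofPred_eq] at *
    rw [mul_add, add_mul, hS, hT]
    module
  zero_mem' := by simp
  smul_mem' c T hT := by
    simp only [Set.mem_ofPred_eq] at *
    rw [mul_smul_comm, hT, smul_mul_assoc]
    module

variable {d}

theorem mem_degPart {n : ℤ} {T : Module.End ℂ V} : T ∈ degPart d n ↔ d * T = T * d + (n : ℂ) • T :=
  Iff.rfl

theorem mul_mem_degPart {m n l : ℤ} {S T : Module.End ℂ V} (hS : S ∈ degPart d m)
    (hT : T ∈ degPart d n) (hl : m + n = l) : S * T ∈ degPart d l := by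
  rw [mem_degPart] at *
  rw [← hl, ← mul_assoc, hS, add_mul, mul_assoc, hT, mul_add, smul_mul_assoc, mul_smul_comm,
    mul_assoc]
  push_cast
  module

theorem mem_degPart_zero {T : Module.End ℂ V} : T ∈ degPart d 0 ↔ Commute d T := by
  simp [mem_degPart, Commute, SemiconjBy]

theorem one_mem_degPart : (1 : Module.End ℂ V) ∈ degPart d 0 :=
  mem_degPart_zero.mpr (Commute.one_right d)

instance gradedMonoid_degPart (σ : ℤ) : SetLike.GradedMonoid fun n : ℕ => degPart d (σ * n) where
  one_mem := by simpa using one_mem_degPart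
  mul_mem _ _ _ _ hS hT := mul_mem_degPart hS hT (by push_cast; ring)

theorem coeff_one_mem_degPart {σ : ℤ} (n : ℕ) :
    coeff n (1 : (Module.End ℂ V)⟦X⟧) ∈ degPart d (σ * n) := by
  rw [coeff_one]
  split_ifs with hn
  · simpa [hn] using one_mem_degPart
  · exact Submodule.zero_mem _

theorem coeff_mul_mem_degPart {σ : ℤ} {f g : (Module.End ℂ V)⟦X⟧}
    (hf : ∀ n : ℕ, coeff n f ∈ degPart d (σ * n))
    (hg : ∀ n : ℕ, coeff n g ∈ degPart d (σ * n)) (n : ℕ) :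
    coeff n (f * g) ∈ degPart d (σ * n) :=
  coeff_mul_mem (fun n : ℕ => degPart d (σ * n)) hf hg n

theorem coeff_formalExp_mem_degPart {σ : ℤ} {f : (Module.End ℂ V)⟦X⟧}
    (hf : ∀ n : ℕ, coeff n f ∈ degPart d (σ * n)) (n : ℕ) :
    coeff n (formalExp f) ∈ degPart d (σ * n) :=
  coeff_formalExp_mem (fun n : ℕ => degPart d (σ * n)) hf n

variable (d)

/-- All operators of degree above `N` annihilate `v`. -/
def KilledAbove (N : ℤ) (v : V) : Prop := ∀ n : ℤ, N < n → ∀ T ∈ degPart d n, T v = 0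

/-- Every vector is annihilated by the operators of large degree. -/
def LocallyBounded : Prop := ∀ v : V, ∃ N : ℤ, KilledAbove d N v

variable {d}

theorem KilledAbove.le_of_mul_apply_ne_zero {N n : ℤ} {v : V} (hv : KilledAbove d N v)
    {S T : Module.End ℂ V} (hT : T ∈ degPart d n) (hST : (S * T) v ≠ 0) : n ≤ N := by
  by_contra! hn
  exact hST (by rw [Module.End.mul_apply, hv n hn T hT, map_zero])

theorem pointwiseSum_mem_degPart {α : Type*} {T : α → Module.End ℂ V} (hT : PointwiseFinite T)
    {n : ℤ} (hn : ∀ a, T a ∈ degPart d n) : pointwiseSum T ∈ degPart d n := by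
  have hsub : d * pointwiseSum T - pointwiseSum T * d = (n : ℂ) • pointwiseSum T := by
    rw [mul_pointwiseSum hT, pointwiseSum_mul hT, smul_pointwiseSum hT,
      ← pointwiseSum_sub (hT.mul_left d) (hT.mul_right d)]
    simp only [fun a => mem_degPart.mp (hn a), add_sub_cancel_left]
  rw [mem_degPart, ← hsub]
  abel

end Degree

/-! ## Dressings of fields -/

/-- A pair of homogeneous series `em(z)`, `ep(z⁻¹)` of operators, by which a field
`G(z) = ∑ G(n) z^{-n}` is to be multiplied from the left and from the right. -/
@[ext]
structure Dressing {V : Type*} [AddCommGroup V] [Module ℂ V] (d : Module.End ℂ V) where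
  em : (Module.End ℂ V)⟦X⟧
  ep : (Module.End ℂ V)⟦X⟧
  em_mem : ∀ r : ℕ, coeff r em ∈ degPart d (-r)
  ep_mem : ∀ s : ℕ, coeff s ep ∈ degPart d s

/-- The modes of `G` are homogeneous, `G n` being of degree `k + n`. -/
def IsHomogeneousField {V : Type*} [AddCommGroup V] [Module ℂ V] (d : Module.End ℂ V) (k : ℤ)
    (G : ℤ → Module.End ℂ V) : Prop := ∀ n, G n ∈ degPart d (k + n)

namespace IsHomogeneousField

variable {V : Type*} [AddCommGroup V] [Module ℂ V] {d : Module.End ℂ V} {k : ℤ}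
  {G : ℤ → Module.End ℂ V}

theorem shift (hG : IsHomogeneousField d k G) (a : ℤ) :
    IsHomogeneousField d (k + a) fun n => G (n + a) :=
  fun n => add_assoc k a n ▸ add_comm n a ▸ hG (n + a)

theorem smul (hG : IsHomogeneousField d k G) (c : ℤ → ℂ) :
    IsHomogeneousField d k fun n => c n • G n :=
  fun n => Submodule.smul_mem _ _ (hG n)

theorem zpow_smul_add (hG : IsHomogeneousField d k G) (c : ℂ) (m : ℤ) :
    IsHomogeneousField d (k + m) fun n => c ^ (m - n) • G (m + n) := by
  simpa only [add_comm m] using (hG.shift m).smul fun n => c ^ (m - n)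

end IsHomogeneousField

namespace Dressing

open Finset

variable {V : Type*} [AddCommGroup V] [Module ℂ V] {d : Module.End ℂ V}

/-- The terms whose sum over `(r, s)` is the coefficient of `z^{-n}` in `em(z) G(z) ep(z⁻¹)`. -/
def term (E : Dressing d) (G : ℤ → Module.End ℂ V) (n : ℤ) (p : ℕ × ℕ) : Module.End ℂ V :=
  coeff p.1 E.em * (G (n + p.1 - p.2) * coeff p.2 E.ep)

/-- The coefficient of `z^{-n}` in `em(z) G(z) ep(z⁻¹)`. -/
def dress (E : Dressing d) (G : ℤ → Module.End ℂ V) (n : ℤ) : Module.End ℂ V :=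
  pointwiseSum fun p => E.term G n p

/-- Dressing by `E * E'` is dressing by `E'` followed by dressing by `E`. -/
instance : Mul (Dressing d) where
  mul E E' :=
    { em := E.em * E'.em
      ep := E'.ep * E.ep
      em_mem r := by
        simpa using coeff_mul_mem_degPart (σ := -1) (by simpa using E.em_mem)
          (by simpa using E'.em_mem) r
      ep_mem s := by
        simpa using coeff_mul_mem_degPart (σ := 1) (by simpa using E'.ep_mem)
          (by simpa using E.ep_mem) s }

instance : One (Dressing d) where
  one :=
    { em := 1
      ep := 1
      em_mem r := by simpa using coeff_one_mem_degPart (d := d) (σ := -1) r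
      ep_mem s := by simpa using coeff_one_mem_degPart (d := d) (σ := 1) s }

/-- The substitution `z ↦ c z`. -/
def scale (c : ℂ) (E : Dressing d) : Dressing d where
  em := scaleX c E.em
  ep := scaleX c⁻¹ E.ep
  em_mem r := by simpa using Submodule.smul_mem _ _ (E.em_mem r)
  ep_mem s := by simpa using Submodule.smul_mem _ _ (E.ep_mem s)

theorem em_mul (E E' : Dressing d) : (E * E').em = E.em * E'.em := rfl

theorem ep_mul (E E' : Dressing d) : (E * E').ep = E'.ep * E.ep := rfl

variable {E E' : Dressing d} {G : ℤ → Module.End ℂ V} {k : ℤ}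

theorem term_mem (hG : IsHomogeneousField d k G) (n : ℤ) (p : ℕ × ℕ) :
    E.term G n p ∈ degPart d (k + n) :=
  mul_mem_degPart (E.em_mem p.1) (mul_mem_degPart (hG _) (E.ep_mem p.2) rfl) (by ring)

theorem pointwiseFinite_term (hd : LocallyBounded d) (hG : IsHomogeneousField d k G) (n : ℤ) :
    PointwiseFinite (E.term G n) := by
  intro v
  obtain ⟨N, hv⟩ := hd v
  refine (Set.finite_Iic ((N - k - n).toNat, N.toNat)).subset fun p hp => ?_
  have hs : (p.2 : ℤ) ≤ N :=
    hv.le_of_mul_apply_ne_zero (S := coeff p.1 E.em * G _) (E.ep_mem p.2) hp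
  have hr : k + (n + p.1 - p.2) + p.2 ≤ N :=
    hv.le_of_mul_apply_ne_zero (S := coeff p.1 E.em) (mul_mem_degPart (hG _) (E.ep_mem p.2) rfl) hp
  exact Prod.mk_le_mk.mpr ⟨by omega, by omega⟩

theorem isHomogeneousField_dress (hd : LocallyBounded d) (hG : IsHomogeneousField d k G) :
    IsHomogeneousField d k (E.dress G) :=
  fun n => pointwiseSum_mem_degPart (pointwiseFinite_term hd hG n) (term_mem hG n)

theorem dress_shift (E : Dressing d) (G : ℤ → Module.End ℂ V) (a n : ℤ) :
    E.dress (fun n => G (n + a)) n = E.dress G (n + a) := by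
  simp only [dress, term, sub_add_eq_add_sub, add_right_comm n]

theorem dress_smul (hd : LocallyBounded d) (hG : IsHomogeneousField d k G) (c : ℂ) (n : ℤ) :
    E.dress (fun n => c • G n) n = c • E.dress G n := by
  rw [dress, dress, smul_pointwiseSum (pointwiseFinite_term hd hG n)]
  simp only [term, smul_mul_assoc, mul_smul_comm]

theorem dress_sub (hd : LocallyBounded d) {G' : ℤ → Module.End ℂ V} (hG : IsHomogeneousField d k G)
    (hG' : IsHomogeneousField d k G') (n : ℤ) :
    E.dress (fun n => G n - G' n) n = E.dress G n - E.dress G' n := by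
  rw [dress, dress, dress, ← pointwiseSum_sub (pointwiseFinite_term hd hG n)
    (pointwiseFinite_term hd hG' n)]
  simp only [term, sub_mul, mul_sub]

theorem dress_zpow_smul (hd : LocallyBounded d) (hG : IsHomogeneousField d k G) {c : ℂ}
    (hc : c ≠ 0) (n : ℤ) :
    E.dress (fun n => c ^ n • G n) n = c ^ n • (E.scale c).dress G n := by
  rw [dress, dress, smul_pointwiseSum (pointwiseFinite_term hd hG n)]
  congr 1
  ext1 p
  simp only [term, scale, coeff_scaleX, smul_mul_assoc, mul_smul_comm, smul_smul]
  congr 1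
  rw [zpow_sub₀ hc, zpow_add₀ hc, zpow_natCast, zpow_natCast, inv_pow]
  ring

theorem dress_one (G : ℤ → Module.End ℂ V) (n : ℤ) : (1 : Dressing d).dress G n = G n := by
  have hone : (1 : Dressing d).em = 1 ∧ (1 : Dressing d).ep = 1 := ⟨rfl, rfl⟩
  rw [dress, pointwiseSum_eq_single (0, 0)]
  · simp [term, hone]
  · rintro ⟨r, s⟩ hrs
    by_cases hr : r = 0
    · have hs : s ≠ 0 := fun hs => hrs (by rw [hr, hs])
      simp [term, hone, coeff_one, hs]
    · simp [term, hone, coeff_one, hr]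

section TwoFields

variable {G : ℤ → ℤ → Module.End ℂ V}

/-- The terms of the coefficient of `z^{-m} w^{-n}` in
`em(z) em'(w) G(z, w) ep'(w⁻¹) ep(z⁻¹)`. -/
def term₂ (E E' : Dressing d) (G : ℤ → ℤ → Module.End ℂ V) (m n : ℤ)
    (pq : (ℕ × ℕ) × (ℕ × ℕ)) : Module.End ℂ V :=
  E.term (fun m => E'.term (G m) n pq.2) m pq.1

/-- The coefficient of `z^{-m} w^{-n}` in `em(z) em'(w) G(z, w) ep'(w⁻¹) ep(z⁻¹)`, the normally
ordered form of a product of two dressed fields. -/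
def dress₂ (E E' : Dressing d) (G : ℤ → ℤ → Module.End ℂ V) (m n : ℤ) : Module.End ℂ V :=
  E.dress (fun m => E'.dress (G m) n) m

theorem dress₂_shift (E E' : Dressing d) (G : ℤ → ℤ → Module.End ℂ V) (a b m n : ℤ) :
    E.dress₂ E' (fun m n => G (m + a) (n + b)) m n = E.dress₂ E' G (m + a) (n + b) := by
  simp only [dress₂, dress_shift]
  exact dress_shift E (fun m => E'.dress (G m) (n + b)) a m

theorem isHomogeneousField_dress_right (hd : LocallyBounded d)
    (hG : ∀ m, IsHomogeneousField d (k + m) (G m)) (n : ℤ) :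
    IsHomogeneousField d (k + n) fun m => E'.dress (G m) n :=
  fun m => add_right_comm k m n ▸ isHomogeneousField_dress hd (hG m) n

theorem dress₂_smul (hd : LocallyBounded d) (hG : ∀ m, IsHomogeneousField d (k + m) (G m)) (c : ℂ)
    (m n : ℤ) : E.dress₂ E' (fun m n => c • G m n) m n = c • E.dress₂ E' G m n := by
  simp only [dress₂, dress_smul hd (hG _),
    dress_smul hd (isHomogeneousField_dress_right (E' := E') hd hG n)]

theorem dress₂_sub (hd : LocallyBounded d) {G' : ℤ → ℤ → Module.End ℂ V}
    (hG : ∀ m, IsHomogeneousField d (k + m) (G m))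
    (hG' : ∀ m, IsHomogeneousField d (k + m) (G' m)) (m n : ℤ) :
    E.dress₂ E' (fun m n => G m n - G' m n) m n = E.dress₂ E' G m n - E.dress₂ E' G' m n := by
  simp only [dress₂, dress_sub hd (hG _) (hG' _),
    dress_sub hd (isHomogeneousField_dress_right (E' := E') hd hG n)
      (isHomogeneousField_dress_right (E' := E') hd hG' n)]

theorem dress₂_smul_shift_sub (hd : LocallyBounded d)
    (hG : ∀ m, IsHomogeneousField d (k + m) (G m)) (c₁ c₂ : ℂ) (m n : ℤ) :
    E.dress₂ E' (fun m n => c₁ • G (m + 1) n - c₂ • G m (n + 1)) m n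
      = c₁ • E.dress₂ E' G (m + 1) n - c₂ • E.dress₂ E' G m (n + 1) := by
  have hG₁ (m : ℤ) : IsHomogeneousField d (k + 1 + m) (G (m + 1)) := by
    simpa only [add_comm m, add_assoc] using hG (m + 1)
  have hG₂ (m : ℤ) : IsHomogeneousField d (k + 1 + m) fun n => G m (n + 1) := by
    simpa only [add_right_comm k] using (hG m).shift 1
  have hshift₁ := dress₂_shift E E' G 1 0 m n
  have hshift₂ := dress₂_shift E E' G 0 1 m n
  simp only [add_zero] at hshift₁ hshift₂
  rw [dress₂_sub hd (fun m => (hG₁ m).smul fun _ => c₁) (fun m => (hG₂ m).smul fun _ => c₂),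
    dress₂_smul hd hG₁, dress₂_smul hd hG₂, hshift₁, hshift₂]

theorem pointwiseFinite_term₂ (hd : LocallyBounded d)
    (hG : ∀ m, IsHomogeneousField d (k + m) (G m)) (m n : ℤ) :
    PointwiseFinite (term₂ E E' G m n) := by
  intro v
  obtain ⟨N, hv⟩ := hd v
  refine (Set.finite_Iic
    (((N - k - m - n).toNat, N.toNat), ((N - k - m - n).toNat, N.toNat))).subset
    fun ⟨p, q⟩ hpq => ?_
  have hep : (coeff q.2 E'.ep * coeff p.2 E.ep) ∈ degPart d (q.2 + p.2) :=
    mul_mem_degPart (E'.ep_mem q.2) (E.ep_mem p.2) rfl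
  have hs : (q.2 + p.2 : ℤ) ≤ N :=
    hv.le_of_mul_apply_ne_zero (S := coeff p.1 E.em * (coeff q.1 E'.em * G _ _)) hep hpq
  have hr : k + (m + p.1 - p.2) + (n + q.1 - q.2) + (q.2 + p.2) ≤ N :=
    hv.le_of_mul_apply_ne_zero (S := coeff p.1 E.em * coeff q.1 E'.em)
      (mul_mem_degPart (hG _ _) hep rfl) hpq
  exact Prod.mk_le_mk.mpr ⟨Prod.mk_le_mk.mpr ⟨by omega, by omega⟩,
    Prod.mk_le_mk.mpr ⟨by omega, by omega⟩⟩

theorem dress₂_eq_pointwiseSum (hd : LocallyBounded d)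
    (hG : ∀ m, IsHomogeneousField d (k + m) (G m)) (m n : ℤ) :
    E.dress₂ E' G m n = pointwiseSum (term₂ E E' G m n) := by
  rw [pointwiseSum_curry (pointwiseFinite_term₂ hd hG m n), dress₂, dress]
  congr 1
  ext1 p
  have hterm := pointwiseFinite_term (E := E') hd (hG (m + p.1 - p.2)) n
  rw [term, dress, pointwiseSum_mul hterm, mul_pointwiseSum (hterm.mul_right _)]
  rfl

theorem dress₂_comm (hd : LocallyBounded d) (hG : ∀ m, IsHomogeneousField d (k + m) (G m))
    (hem : CoeffCommute E.em E'.em) (hep : CoeffCommute E.ep E'.ep) (m n : ℤ) :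
    E'.dress₂ E (fun n m => G m n) n m = E.dress₂ E' G m n := by
  have hG' (n : ℤ) : IsHomogeneousField d (k + n) fun m => G m n :=
    fun m => add_right_comm k m n ▸ hG m n
  rw [dress₂_eq_pointwiseSum hd hG, dress₂_eq_pointwiseSum hd hG',
    ← pointwiseSum_comp_equiv (Equiv.prodComm _ _)]
  congr 1
  ext1 ⟨p, q⟩
  simp only [term₂, term, Equiv.prodComm_apply, Prod.fst_swap, Prod.snd_swap, mul_assoc,
    (hep p.2 q.2).eq]
  rw [← mul_assoc, ← (hem p.1 q.1).eq, mul_assoc]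

theorem dress_mul (hd : LocallyBounded d) {Θ : ℤ → Module.End ℂ V} (hΘ : IsHomogeneousField d k Θ)
    (n : ℤ) : (E * E').dress Θ n = E.dress (E'.dress Θ) n := by
  have hG (m : ℤ) : IsHomogeneousField d (k + m) fun n => Θ (n + m) := hΘ.shift m
  have hshift (m : ℤ) : E'.dress Θ m = E'.dress (fun n => Θ (n + m)) 0 := by
    rw [dress_shift, zero_add]
  have hmem (a : (ℕ × ℕ) × (ℕ × ℕ)) (b : ℕ × ℕ) :
      a ∈ antidiagonal b.1 ×ˢ antidiagonal b.2 ↔ (a.1.1 + a.1.2, a.2.1 + a.2.2) = b := by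
    simp [Prod.ext_iff]
  -- `((r, s), (r', s'))` is sorted as `((r, r'), (s', s))`, to be summed along `(r + r', s' + s)`.
  let e : (ℕ × ℕ) × (ℕ × ℕ) ≃ (ℕ × ℕ) × (ℕ × ℕ) :=
    { toFun a := ((a.1.1, a.2.2), (a.1.2, a.2.1))
      invFun a := ((a.1.1, a.2.1), (a.2.2, a.1.2)) }
  have hfin : PointwiseFinite fun a => term₂ E E' (fun m n => Θ (n + m)) n 0 (e a) :=
    (pointwiseFinite_term₂ hd hG n 0).comp_equiv e
  simp only [funext hshift]
  rw [← dress₂, dress₂_eq_pointwiseSum hd hG, ← pointwiseSum_comp_equiv e,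
    ← pointwiseSum_fiber hfin hmem, dress]
  congr 1
  ext1 ⟨ρ, σ⟩
  simp only [term, em_mul, ep_mul, coeff_mul, Finset.sum_mul, Finset.mul_sum, Finset.sum_product]
  rw [Finset.sum_comm]
  refine Finset.sum_congr rfl fun p hp => Finset.sum_congr rfl fun q hq => ?_
  rw [← mem_antidiagonal.mp hp, ← mem_antidiagonal.mp hq]
  simp only [term₂, term, e, Equiv.coe_fn_mk, mul_assoc]
  congr 4
  push_cast
  ring

theorem dress₂_zpow_smul (hd : LocallyBounded d) {Θ : ℤ → Module.End ℂ V}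
    (hΘ : IsHomogeneousField d k Θ) {c : ℂ} (hc : c ≠ 0) (m n : ℤ) :
    E.dress₂ E' (fun m n => c ^ (m - n) • Θ (m + n)) m n
      = c ^ (m - n) • (E.scale c * E'.scale c⁻¹).dress Θ (m + n) := by
  set Θ' := (E'.scale c⁻¹).dress Θ with hΘ'
  have hom : IsHomogeneousField d k Θ' := isHomogeneousField_dress hd hΘ
  have inner (m : ℤ) : E'.dress (fun n => c ^ (m - n) • Θ (m + n)) n
      = c⁻¹ ^ n • c ^ m • Θ' (m + n) := by
    have hfield : (fun n => c ^ (m - n) • Θ (m + n)) = fun n => c⁻¹ ^ n • c ^ m • Θ (n + m) := by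
      ext1 n
      rw [zpow_sub₀ hc, div_eq_mul_inv, mul_comm, mul_smul, inv_zpow, add_comm m]
    rw [hfield, dress_zpow_smul hd ((hΘ.shift m).smul _) (inv_ne_zero hc),
      dress_smul hd (hΘ.shift m), dress_shift, add_comm m]
  simp only [dress₂, inner]
  rw [dress_smul hd ((hom.shift n).smul _), dress_zpow_smul hd (hom.shift n) hc, dress_shift, hΘ',
    ← dress_mul hd hΘ, smul_smul, zpow_sub₀ hc, inv_zpow, mul_comm, div_eq_mul_inv]

theorem dress₂_zpow_smul_dress (hd : LocallyBounded d) {Θ : ℤ → Module.End ℂ V}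
    (hΘ : IsHomogeneousField d k Θ) {c : ℂ} (hc : c ≠ 0) {H : Dressing d}
    (hH : E.scale c * E'.scale c⁻¹ * H = 1) (m n : ℤ) :
    E.dress₂ E' (fun m n => c ^ (m - n) • H.dress Θ (m + n)) m n = c ^ (m - n) • Θ (m + n) := by
  rw [dress₂_zpow_smul hd (isHomogeneousField_dress hd hΘ) hc, ← dress_mul hd hΘ, hH, dress_one]

end TwoFields

theorem mul_term_sub_term_mul {y : Module.End ℂ V} {m : ℕ} {c : ℂ}
    (hem : C y * E.em = E.em * C y - c • (X ^ m * E.em))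
    (hy : ∀ p, y * G p = G p * y + c • G (p + m)) (hep : ∀ s, Commute y (coeff s E.ep)) (n : ℤ)
    (p : ℕ × ℕ) :
    y * E.term G n p - E.term G n p * y = c • (E.term G (n + m) p
      - ∑ a ∈ if m ≤ p.1 then {(p.1 - m, p.2)} else ∅, E.term G (n + m) a) := by
  obtain ⟨r, s⟩ := p
  have hr : y * coeff r E.em = coeff r E.em * y
      - c • if m ≤ r then coeff (r - m) E.em else 0 := by
    simpa only [map_sub, coeff_C_mul, coeff_mul_C, coeff_smul, coeff_X_pow_mul']
      using congr(coeff r $hem)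
  have hmr (hr : m ≤ r) : n + m + ((r - m : ℕ) : ℤ) = n + r := by omega
  calc
    _ = y * coeff r E.em * (G (n + r - s) * coeff s E.ep)
        - coeff r E.em * (G (n + r - s) * (y * coeff s E.ep)) := by
      simp only [term, mul_assoc, (hep s).eq]
    _ = _ := by
      rw [hr, sub_mul, mul_assoc, ← mul_assoc y, hy]
      split_ifs with hle <;>
        simp only [term, hmr, hle, add_mul, mul_add, mul_assoc, smul_mul_assoc, mul_smul_comm,
          Finset.sum_singleton, Finset.sum_empty, smul_sub, smul_zero, sub_zero, zero_mul,
          sub_add_eq_add_sub, add_right_comm n] <;> abel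

theorem commute_dress (hd : LocallyBounded d) (hG : IsHomogeneousField d k G)
    {y : Module.End ℂ V} {m : ℕ} {c : ℂ} (hem : C y * E.em = E.em * C y - c • (X ^ m * E.em))
    (hy : ∀ p, y * G p = G p * y + c • G (p + m)) (hep : ∀ s, Commute y (coeff s E.ep)) (n : ℤ) :
    Commute y (E.dress G n) := by
  have hfin := pointwiseFinite_term (E := E) hd hG (n + m)
  have hfiber (a b : ℕ × ℕ) :
      (a ∈ if m ≤ b.1 then {(b.1 - m, b.2)} else (∅ : Finset (ℕ × ℕ))) ↔ (a.1 + m, a.2) = b := by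
    split_ifs <;> simp [Prod.ext_iff] <;> omega
  have hfin' : PointwiseFinite fun b : ℕ × ℕ =>
    ∑ a ∈ if m ≤ b.1 then {(b.1 - m, b.2)} else ∅, E.term G (n + m) a := hfin.fiber hfiber
  rw [Commute, SemiconjBy, ← sub_eq_zero, dress,
    mul_pointwiseSum (pointwiseFinite_term hd hG n),
    pointwiseSum_mul (pointwiseFinite_term hd hG n),
    ← pointwiseSum_sub ((pointwiseFinite_term hd hG n).mul_left y)
      ((pointwiseFinite_term hd hG n).mul_right y), funext (mul_term_sub_term_mul hem hy hep n),
    ← smul_pointwiseSum (fun v => (hfin v).sub (hfin' v)), pointwiseSum_sub hfin hfin',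
    pointwiseSum_fiber hfin hfiber, sub_self, smul_zero]

section NormalOrdering

variable {x x' : ℤ → Module.End ℂ V} {P : ℂ⟦X⟧} {l : ℤ}

theorem pointwiseFinite_smul_mul {Y : ℤ → Module.End ℂ V} (hd : LocallyBounded d)
    (hY : IsHomogeneousField d l Y) (P : ℂ⟦X⟧) (x : ℤ → Module.End ℂ V) (m n : ℤ) :
    PointwiseFinite fun u : ℕ => coeff u P • (x (m - u) * Y (n + u)) := by
  intro v
  obtain ⟨N, hv⟩ := hd v
  refine (Set.finite_Iic (N - l - n).toNat).subset fun u hu => ?_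
  have hu' : l + (n + u) ≤ N :=
    hv.le_of_mul_apply_ne_zero (S := coeff u P • x (m - u)) (hY _) hu
  exact Set.mem_Iic.mpr (by omega)

theorem pointwiseFinite_smul_mul_term (hd : LocallyBounded d) (hx' : IsHomogeneousField d l x')
    (P : ℂ⟦X⟧) (x : ℤ → Module.End ℂ V) (m n : ℤ) :
    PointwiseFinite fun a : ℕ × ℕ × ℕ =>
      coeff a.1 P • (x (m - a.1) * E'.term x' (n + a.1) a.2) := by
  intro v
  obtain ⟨N, hv⟩ := hd v
  refine (Set.finite_Iic ((N - l - n).toNat, (N - l - n).toNat, N.toNat)).subset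
    fun ⟨u, t, s⟩ ha => ?_
  have hs : (s : ℤ) ≤ N :=
    hv.le_of_mul_apply_ne_zero
      (S := coeff u P • (x (m - u) * (coeff t E'.em * x' _))) (E'.ep_mem s) ha
  have hut : l + (n + u + t - s) + s ≤ N :=
    hv.le_of_mul_apply_ne_zero (S := coeff u P • (x (m - u) * coeff t E'.em))
      (mul_mem_degPart (hx' _) (E'.ep_mem s) rfl) ha
  exact Prod.mk_le_mk.mpr ⟨by omega, Prod.mk_le_mk.mpr ⟨by omega, by omega⟩⟩

theorem pointwiseFinite_term_smul_mul {Y : ℤ → Module.End ℂ V} (hd : LocallyBounded d)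
    (hx : IsHomogeneousField d k x) (hY : IsHomogeneousField d l Y) (P : ℂ⟦X⟧) (m n : ℤ) :
    PointwiseFinite fun a : ℕ × ℕ × ℕ =>
      E.term (fun m => coeff a.1 P • (x (m - a.1) * Y (n + a.1))) m a.2 := by
  intro v
  obtain ⟨N, hv⟩ := hd v
  refine (Set.finite_Iic ((N - l - n).toNat, (N - k - l - m - n).toNat, N.toNat)).subset
    fun ⟨u, r, s⟩ ha => ?_
  have hYep : Y (n + u) * coeff s E.ep ∈ degPart d (l + (n + u) + s) :=
    mul_mem_degPart (hY _) (E.ep_mem s) rfl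
  have hs : (s : ℤ) ≤ N :=
    hv.le_of_mul_apply_ne_zero (S := coeff r E.em * (coeff u P • (x _ * Y _))) (E.ep_mem s) ha
  have hu : l + (n + u) + s ≤ N :=
    hv.le_of_mul_apply_ne_zero (S := coeff r E.em * (coeff u P • x (m + r - s - u))) hYep ha
  have hr : k + (m + r - s - u) + (l + (n + u) + s) ≤ N :=
    hv.le_of_mul_apply_ne_zero (S := coeff r E.em * coeff u P • 1)
      (mul_mem_degPart (hx _) hYep rfl) (by simpa [term, smul_mul_assoc] using ha)
  exact Prod.mk_le_mk.mpr ⟨by omega, Prod.mk_le_mk.mpr ⟨by omega, by omega⟩⟩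

theorem dress_mul_left_eq_pointwiseSum (hd : LocallyBounded d) (hx' : IsHomogeneousField d l x')
    (hP : ∀ p, E'.em * C (x p) = (PowerSeries.mk fun r : ℕ => coeff r P • x (p - r)) * E'.em)
    (m n : ℤ) :
    E'.dress (fun n => x m * x' n) n
      = pointwiseSum (fun u : ℕ => coeff u P • (x (m - u) * E'.dress x' (n + u))) := by
  have hfin := pointwiseFinite_smul_mul_term (E' := E') hd hx' P x m n
  have hdress (u : ℕ) : coeff u P • (x (m - u) * E'.dress x' (n + u))
      = pointwiseSum fun p => coeff u P • (x (m - u) * E'.term x' (n + u) p) := by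
    have hterm := pointwiseFinite_term (E := E') hd hx' (n + u)
    rw [dress, mul_pointwiseSum hterm, smul_pointwiseSum (hterm.mul_left _)]
  have hmem (a : (ℕ × ℕ) × ℕ) (b : ℕ × ℕ) :
      a ∈ antidiagonal b.1 ×ˢ {b.2} ↔ (a.1.1 + a.1.2, a.2) = b := by
    rw [mem_product, HasAntidiagonal.mem_antidiagonal, mem_singleton, Prod.ext_iff]
  simp only [hdress]
  rw [← pointwiseSum_curry hfin, ← pointwiseSum_comp_equiv (Equiv.prodAssoc ℕ ℕ ℕ),
    ← pointwiseSum_fiber (hfin.comp_equiv (Equiv.prodAssoc ℕ ℕ ℕ)) hmem, dress]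
  congr 1
  ext1 ⟨r, s⟩
  have hr := congr(coeff r $(hP m))
  rw [coeff_mul_C, coeff_mul] at hr
  rw [term, ← mul_assoc, ← mul_assoc, hr, Finset.sum_mul, Finset.sum_mul, Finset.sum_product]
  refine Finset.sum_congr rfl fun q hq => ?_
  rw [Finset.sum_singleton, ← mem_antidiagonal.mp hq]
  simp only [term, Equiv.prodAssoc_apply, coeff_mk, smul_mul_assoc, mul_assoc, Nat.cast_add,
    add_assoc]

theorem pointwiseSum_smul_dress_mul {Y : ℤ → Module.End ℂ V} (hd : LocallyBounded d)
    (hx : IsHomogeneousField d k x) (hY : IsHomogeneousField d l Y)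
    (hc : ∀ s n, Commute (coeff s E.ep) (Y n)) (m n : ℤ) :
    pointwiseSum (fun u : ℕ => coeff u P • (E.dress x (m - u) * Y (n + u)))
      = E.dress (fun m => pointwiseSum fun u : ℕ => coeff u P • (x (m - u) * Y (n + u))) m := by
  have hfin := pointwiseFinite_term_smul_mul (E := E) hd hx hY P m n
  have hdress (u : ℕ) : coeff u P • (E.dress x (m - u) * Y (n + u))
      = pointwiseSum (E.term (fun m => coeff u P • (x (m - u) * Y (n + u))) m) := by
    have hterm := pointwiseFinite_term (E := E) hd hx (m - u)
    rw [dress, pointwiseSum_mul hterm, smul_pointwiseSum (hterm.mul_right _)]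
    congr 1
    ext1 p
    simp only [term, mul_assoc, (hc _ _).eq, smul_mul_assoc, mul_smul_comm,
      sub_add_eq_add_sub, sub_right_comm]
  simp only [hdress]
  rw [← pointwiseSum_curry hfin, ← pointwiseSum_comp_equiv (Equiv.prodComm (ℕ × ℕ) ℕ),
    pointwiseSum_curry (hfin.comp_equiv (Equiv.prodComm (ℕ × ℕ) ℕ)), dress]
  congr 1
  ext1 p
  have hprod := pointwiseFinite_smul_mul hd hY P x (m + p.1 - p.2) n
  rw [term, pointwiseSum_mul hprod, mul_pointwiseSum (hprod.mul_right _)]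
  rfl

theorem pointwiseSum_smul_dress_mul_dress (hd : LocallyBounded d) (hx : IsHomogeneousField d k x)
    (hx' : IsHomogeneousField d l x')
    (hP : ∀ p, E'.em * C (x p) = (PowerSeries.mk fun r : ℕ => coeff r P • x (p - r)) * E'.em)
    (hc : ∀ s n, Commute (coeff s E.ep) (E'.dress x' n)) (m n : ℤ) :
    pointwiseSum (fun u : ℕ => coeff u P • (E.dress x (m - u) * E'.dress x' (n + u)))
      = E.dress₂ E' (fun m n => x m * x' n) m n := by
  simp only [dress₂, dress_mul_left_eq_pointwiseSum hd hx' hP]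
  exact pointwiseSum_smul_dress_mul hd hx (isHomogeneousField_dress hd hx') hc m n

end NormalOrdering

theorem dress_single_of_em_eq_one (hE : E.em = 1) (K : Module.End ℂ V) (n : ℤ) :
    E.dress (Pi.single 0 K) n = if 0 ≤ n then K * coeff n.toNat E.ep else 0 := by
  have hterm (p : ℕ × ℕ) (hp : p ≠ (0, n.toNat)) : E.term (Pi.single 0 K) n p = 0 := by
    obtain ⟨r, s⟩ := p
    by_cases hr : r = 0
    · have hs : n - s ≠ 0 := fun hs => hp (by rw [hr, Prod.mk.injEq]; omega)
      simp [term, hr, Pi.single_eq_of_ne hs]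
    · simp [term, hE, coeff_one, hr]
  rw [dress, pointwiseSum_eq_single _ hterm]
  split_ifs with hn
  · simp [term, hE, hn]
  · have hn' : n - max n 0 ≠ 0 := by omega
    simp [term, Pi.single_eq_of_ne hn']

theorem dress_single_of_ep_eq_one (hE : E.ep = 1) (K : Module.End ℂ V) (n : ℤ) :
    E.dress (Pi.single 0 K) n = if n ≤ 0 then coeff (-n).toNat E.em * K else 0 := by
  have hterm (p : ℕ × ℕ) (hp : p ≠ ((-n).toNat, 0)) : E.term (Pi.single 0 K) n p = 0 := by
    obtain ⟨r, s⟩ := p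
    by_cases hs : s = 0
    · have hr : n + r ≠ 0 := fun hr => hp (by rw [hs, Prod.mk.injEq]; omega)
      simp [term, hs, Pi.single_eq_of_ne hr]
    · simp [term, hE, coeff_one, hs]
  rw [dress, pointwiseSum_eq_single _ hterm]
  split_ifs with hn
  · have hn' : n + max (-n) 0 = 0 := by omega
    simp [term, hE, hn']
  · have hn' : n + max (-n) 0 ≠ 0 := by omega
    simp [term, Pi.single_eq_of_ne hn']

theorem isHomogeneousField_single {K : Module.End ℂ V} (hK : K ∈ degPart d k) :
    IsHomogeneousField d k (Pi.single 0 K) := by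
  intro n
  by_cases hn : n = 0
  · simpa [hn] using hK
  · simp [Pi.single_eq_of_ne hn]

end Dressing

/-! ## Powers of `q` -/

section QPow

variable (h : ℂ)

theorem qpow_add (a b : ℚ) : qpow h (a + b) = qpow h a * qpow h b := by
  rw [qpow, qpow, qpow, ← Complex.exp_add]
  push_cast
  ring_nf

@[simp]
theorem qpow_zero : qpow h 0 = 1 := by simp [qpow]

theorem qpow_ne_zero (a : ℚ) : qpow h a ≠ 0 := Complex.exp_ne_zero _

theorem qpow_neg (a : ℚ) : qpow h (-a) = (qpow h a)⁻¹ := by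
  rw [qpow, qpow, ← Complex.exp_neg]
  push_cast
  ring_nf

theorem qpow_mul_natCast (a : ℚ) (n : ℕ) : qpow h (a * n) = qpow h a ^ n := by
  rw [qpow, qpow, ← Complex.exp_nat_mul]
  push_cast
  ring_nf

theorem qpow_mul_intCast (a : ℚ) (n : ℤ) : qpow h (a * n) = qpow h a ^ n := by
  rw [qpow, qpow, ← Complex.exp_int_mul]
  push_cast
  ring_nf

theorem qnum_neg (a : ℚ) : qnum h (-a) = -qnum h a := by
  rw [qnum, qnum, neg_neg]
  ring

variable {h}

theorem qpow_ne_one (hq : ∀ n : ℕ, 0 < n → Complex.exp h ^ n ≠ 1) {a : ℚ} (ha : a ≠ 0) :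
    qpow h a ≠ 1 := by
  have key : ∀ b : ℚ, 0 < b → qpow h b ≠ 1 := by
    intro b hb hb1
    apply hq b.num.toNat (by simpa using Rat.num_pos.mpr hb)
    have h1 : qpow h (b * b.den) = 1 := by rw [qpow_mul_natCast, hb1, one_pow]
    have h2 : (b.num.toNat : ℚ) = b * b.den := by
      rw [Rat.mul_den_eq_num]
      exact_mod_cast Int.toNat_of_nonneg (Rat.num_pos.mpr hb).le
    rw [← h2, ← one_mul (b.num.toNat : ℚ), qpow_mul_natCast] at h1
    simpa [qpow] using h1
  rcases lt_or_gt_of_ne ha with ha | ha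
  · intro h1
    apply key (-a) (neg_pos.mpr ha)
    rw [qpow_neg, h1, inv_one]
  · exact key a ha

theorem qpow_sub_qpow_neg_ne_zero (hq : ∀ n : ℕ, 0 < n → Complex.exp h ^ n ≠ 1) {a : ℚ}
    (ha : a ≠ 0) : qpow h a - qpow h (-a) ≠ 0 := by
  intro h0
  apply qpow_ne_one hq (a := a + a) (by simpa [← two_mul] using ha)
  rw [qpow_add]
  nth_rw 1 [sub_eq_zero.mp h0]
  rw [← qpow_add, neg_add_cancel, qpow_zero]

theorem qnum_mul_natCast_ne_zero (hq : ∀ n : ℕ, 0 < n → Complex.exp h ^ n ≠ 1) {κ : ℚ}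
    (hκ : κ ≠ 0) {n : ℕ} (hn : n ≠ 0) : qnum h (κ * n) ≠ 0 :=
  div_ne_zero (qpow_sub_qpow_neg_ne_zero hq (mul_ne_zero hκ (Nat.cast_ne_zero.mpr hn)))
    (qpow_sub_qpow_neg_ne_zero hq one_ne_zero)

end QPow

section ExpSeries

variable {A : Type*} [Ring A] [Algebra ℂ A]

/-- The series `exp (∑ α_n g_n X^n)`; the exponent is meant to have no constant term. -/
def expSeries (g : ℕ → A) (α : ℕ → ℂ) : A⟦X⟧ := formalExp (PowerSeries.mk fun n => α n • g n)

theorem map_coeff_expSeries {A' : Type*} [Ring A'] [Algebra ℂ A'] (φ : A →ₐ[ℂ] A') (g : ℕ → A)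
    (α : ℕ → ℂ) (n : ℕ) :
    φ (coeff n (expSeries g α)) = coeff n (expSeries (fun m => φ (g m)) α) := by
  have hmap : PowerSeries.map (φ : A →+* A') (PowerSeries.mk fun n => α n • g n)
      = PowerSeries.mk fun n => α n • φ (g n) := by
    ext m
    simp
  rw [expSeries, expSeries, ← hmap, ← map_formalExp, coeff_map]
  rfl

theorem scaleX_expSeries (c : ℂ) (g : ℕ → A) (α : ℕ → ℂ) :
    scaleX c (expSeries g α) = expSeries g fun n => c ^ n * α n := by
  rw [expSeries, scaleX_formalExp, expSeries]
  congr 1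
  ext n
  simp [smul_smul]

theorem coeffCommute_mk_smul {g g' : ℕ → A} (hg : ∀ m n, Commute (g m) (g' n)) (α β : ℕ → ℂ) :
    CoeffCommute (PowerSeries.mk fun n => α n • g n) (PowerSeries.mk fun n => β n • g' n) := by
  intro m n
  simp only [coeff_mk]
  exact ((hg m n).smul_left _).smul_right _

theorem commute_coeff_expSeries {y : A} {g : ℕ → A} (hy : ∀ m, Commute y (g m)) (α : ℕ → ℂ)
    (n : ℕ) : Commute y (coeff n (expSeries g α)) :=
  commute_coeff_formalExp (fun m => by rw [coeff_mk]; exact (hy m).smul_right _) n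

theorem constantCoeff_mk_smul {g : ℕ → A} (h0 : g 0 = 0) (α : ℕ → ℂ) :
    constantCoeff (PowerSeries.mk fun n => α n • g n) = 0 := by
  rw [← coeff_zero_eq_constantCoeff_apply, coeff_mk, h0, smul_zero]

theorem expSeries_mul {g : ℕ → A} (h0 : g 0 = 0) (hg : ∀ m n, Commute (g m) (g n))
    (α β : ℕ → ℂ) :
    expSeries g α * expSeries g β = expSeries g (α + β) := by
  have hcomm := coeffCommute_mk_smul hg
  rw [expSeries, expSeries, ← formalExp_add (constantCoeff_mk_smul h0 α)
    (constantCoeff_mk_smul h0 β) (hcomm α α) (hcomm β β) (hcomm α β), expSeries]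
  congr 1
  ext n
  simp [add_smul]

theorem expSeries_eq_one {g : ℕ → A} (h0 : g 0 = 0) {α : ℕ → ℂ} (hα : ∀ n, n ≠ 0 → α n = 0) :
    expSeries g α = 1 := by
  have hexponent : (PowerSeries.mk fun n => α n • g n) = 0 := by
    ext n
    rcases eq_or_ne n 0 with rfl | hn
    · simp [h0]
    · simp [hα n hn]
  rw [expSeries, hexponent, formalExp_zero]

theorem coeff_expSeries_mem_degPart {V : Type*} [AddCommGroup V] [Module ℂ V] {d : Module.End ℂ V}
    {σ : ℤ} {g : ℕ → Module.End ℂ V} (hg : ∀ n : ℕ, g n ∈ degPart d (σ * n)) (α : ℕ → ℂ) (n : ℕ) :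
    coeff n (expSeries g α) ∈ degPart d (σ * n) :=
  coeff_formalExp_mem_degPart (fun m => by
    rw [coeff_mk]
    exact Submodule.smul_mem _ _ (hg m)) n

end ExpSeries

/-! ## Operators on a module -/

section Operators

variable {ι : Type*} [Fintype ι] (C : CartanDatum ι) (h : ℂ)
variable (V : Type*) [AddCommGroup V] [Module ℂ V] [Module (Uq C h) V] [IsScalarTower ℂ (Uq C h) V]

/-- The representation on `V`, pulled back to the free algebra. -/
def freeRep : FreeAlgebra ℂ (Gen ι) →ₐ[ℂ] Module.End ℂ V :=
  (Algebra.lsmul ℂ ℂ V : Uq C h →ₐ[ℂ] Module.End ℂ V).comp (Uq.mk C h)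

/-- The operator `d`. -/
def dOp : Module.End ℂ V := Algebra.lsmul ℂ ℂ V (Uq.d C h)

/-- The operators `a_i(n)`, with `a_i(0) = 0`. -/
def aOp (i : ι) (n : ℤ) : Module.End ℂ V := Algebra.lsmul ℂ ℂ V (Uq.a C h i n)

/-- The operators `x_i^±(n)`. -/
def xOp (ε : ℤˣ) (i : ι) (n : ℤ) : Module.End ℂ V := Algebra.lsmul ℂ ℂ V (Uq.x C h ε i n)

/-- The operators `k_i`. -/
def kOp (i : ι) : Module.End ℂ V := Algebra.lsmul ℂ ℂ V (Uq.k C h i)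

/-- The operators `k_i⁻¹`. -/
def kInvOp (i : ι) : Module.End ℂ V := Algebra.lsmul ℂ ℂ V (Uq.kInv C h i)

theorem freeRep_gen_d : freeRep C h V (Free.gen Gen.d) = dOp C h V := rfl

theorem freeRep_a (i : ι) (n : ℤ) : freeRep C h V (Free.a i n) = aOp C h V i n := rfl

theorem freeRep_x (ε : ℤˣ) (i : ι) (n : ℤ) :
    freeRep C h V (Free.x ε i n) = xOp C h V ε i n := rfl

theorem freeRep_gen_k (i : ι) : freeRep C h V (Free.gen (Gen.k i)) = kOp C h V i := rfl

theorem freeRep_gen_kInv (i : ι) :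
    freeRep C h V (Free.gen (Gen.kInv i)) = kInvOp C h V i := rfl

variable {C h V}

theorem freeRep_rel {s t : FreeAlgebra ℂ (Gen ι)} (hst : Rel C h s t) :
    freeRep C h V s = freeRep C h V t :=
  congrArg (Algebra.lsmul ℂ ℂ V : Uq C h →ₐ[ℂ] Module.End ℂ V) (RingQuot.mkAlgHom_rel ℂ hst)

variable (C h V)

@[simp]
theorem aOp_zero (i : ι) : aOp C h V i 0 = 0 := by
  rw [← freeRep_a, Free.a]
  simp

theorem aOp_mem (i : ι) (n : ℤ) : aOp C h V i n ∈ degPart (dOp C h V) n := by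
  simpa only [mem_degPart, map_sub, map_mul, map_smul, freeRep_a, freeRep_gen_d,
    sub_eq_iff_eq_add'] using
    freeRep_rel (V := V) (Rel.d_a (C := C) (h := h) i n)

theorem isHomogeneousField_xOp (ε : ℤˣ) (i : ι) :
    IsHomogeneousField (dOp C h V) 0 (xOp C h V ε i) := by
  intro n
  simpa only [zero_add, mem_degPart, map_sub, map_mul, map_smul, freeRep_x, freeRep_gen_d,
    sub_eq_iff_eq_add'] using
    freeRep_rel (V := V) (Rel.d_x (C := C) (h := h) ε i n)

/-- `k_i` as an invertible operator, with inverse `k_i⁻¹`. -/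
def kUnit (i : ι) : (Module.End ℂ V)ˣ where
  val := kOp C h V i
  inv := kInvOp C h V i
  val_inv := by
    simpa only [map_mul, map_one, freeRep_gen_k, freeRep_gen_kInv] using
      freeRep_rel (V := V) (Rel.k_mul_inv (C := C) (h := h) i)
  inv_val := by
    simpa only [map_mul, map_one, freeRep_gen_k, freeRep_gen_kInv] using
      freeRep_rel (V := V) (Rel.k_inv_mul (C := C) (h := h) i)

variable {C h V} in
theorem commute_kInvOp {i : ι} {T : Module.End ℂ V} (hT : Commute (kOp C h V i) T) :
    Commute (kInvOp C h V i) T :=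
  Commute.units_inv_left (u := kUnit C h V i) hT

theorem commute_kOp_dOp (i : ι) : Commute (kOp C h V i) (dOp C h V) := by
  simpa only [map_mul, freeRep_gen_k, freeRep_gen_d, commute_iff_eq] using
    freeRep_rel (V := V) (Rel.k_d (C := C) (h := h) i)

theorem commute_kOp_aOp (i j : ι) (n : ℤ) : Commute (kOp C h V i) (aOp C h V j n) := by
  simpa only [map_mul, freeRep_gen_k, freeRep_a, commute_iff_eq] using
    freeRep_rel (V := V) (Rel.k_a (C := C) (h := h) i j n)

theorem kOp_mem (i : ι) : kOp C h V i ∈ degPart (dOp C h V) 0 :=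
  mem_degPart_zero.mpr (commute_kOp_dOp C h V i).symm

theorem kInvOp_mem (i : ι) : kInvOp C h V i ∈ degPart (dOp C h V) 0 :=
  mem_degPart_zero.mpr (commute_kInvOp (commute_kOp_dOp C h V i)).symm

theorem xOp_xOp (ε : ℤˣ) (i j : ι) (m n : ℤ) :
    xOp C h V ε i (m + 1) * xOp C h V ε j n
        - qpow h (((ε : ℤ) : ℚ) * C.form i j) • (xOp C h V ε i m * xOp C h V ε j (n + 1))
      = qpow h (((ε : ℤ) : ℚ) * C.form i j) • (xOp C h V ε j n * xOp C h V ε i (m + 1))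
        - xOp C h V ε j (n + 1) * xOp C h V ε i m := by
  simpa only [map_sub, map_mul, map_smul, freeRep_x] using
    freeRep_rel (V := V) (Rel.x_x (C := C) (h := h) ε i j m n)

theorem commute_xOp_of_ne {i j : ι} (hij : i ≠ j) (m n : ℤ) :
    Commute (xOp C h V 1 i m) (xOp C h V (-1) j n) := by
  rw [Commute, SemiconjBy, ← sub_eq_zero]
  simpa only [map_sub, map_mul, map_zero, freeRep_x] using
    freeRep_rel (V := V) (Rel.x_plus_minus_of_ne (C := C) (h := h) i j hij m n)

theorem CartanDatum.form_comm (i j : ι) : C.form i j = C.form j i := C.symm i j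

/-- The dressing by `exp (∑ α_n a_i(-n) z^n)` and `exp (∑ β_n a_i(n) z^{-n})`. -/
def heisenbergDressing (i : ι) (α β : ℕ → ℂ) : Dressing (dOp C h V) where
  em := expSeries (fun n : ℕ => aOp C h V i (-n)) α
  ep := expSeries (fun n : ℕ => aOp C h V i n) β
  em_mem r := by
    simpa using coeff_expSeries_mem_degPart (σ := -1)
      (by simpa using fun n : ℕ => aOp_mem C h V i (-n)) α r
  ep_mem s := by
    simpa using coeff_expSeries_mem_degPart (σ := 1)
      (by simpa using fun n : ℕ => aOp_mem C h V i n) β s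

theorem heisenbergDressing_eq_one (i : ι) {α β : ℕ → ℂ} (hα : ∀ n, n ≠ 0 → α n = 0)
    (hβ : ∀ n, n ≠ 0 → β n = 0) : heisenbergDressing C h V i α β = 1 :=
  Dressing.ext (expSeries_eq_one (by simp) hα) (expSeries_eq_one (by simp) hβ)

theorem scale_heisenbergDressing (c : ℂ) (i : ι) (α β : ℕ → ℂ) :
    (heisenbergDressing C h V i α β).scale c
      = heisenbergDressing C h V i (fun n => c ^ n * α n) fun n => c⁻¹ ^ n * β n :=
  Dressing.ext (scaleX_expSeries c _ α) (scaleX_expSeries c⁻¹ _ β)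

theorem freeRep_psi (i : ι) (n : ℤ) :
    freeRep C h V (Free.psi h i n)
      = (heisenbergDressing C h V i 0 fun _ => qpow h 1 - qpow h (-1)).dress
          (Pi.single 0 (kOp C h V i)) n := by
  rw [Dressing.dress_single_of_em_eq_one (expSeries_eq_one (by simp) (by simp)), Free.psi,
    apply_ite (freeRep C h V), map_zero, map_mul, freeRep_gen_k, ← expSeries, map_coeff_expSeries]
  rfl

theorem freeRep_phi (i : ι) (n : ℤ) :
    freeRep C h V (Free.phi h i n)
      = (heisenbergDressing C h V i (fun _ => qpow h (-1) - qpow h 1) 0).dress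
          (Pi.single 0 (kInvOp C h V i)) n := by
  have hcomm := commute_coeff_expSeries
    (fun m : ℕ => commute_kInvOp (commute_kOp_aOp C h V i i (-m)))
    (fun _ => qpow h (-1) - qpow h 1) (-n).toNat
  rw [Dressing.dress_single_of_ep_eq_one (expSeries_eq_one (by simp) (by simp)), Free.phi,
    apply_ite (freeRep C h V), map_zero, map_mul, freeRep_gen_kInv, ← expSeries,
    map_coeff_expSeries, heisenbergDressing, ← hcomm.eq]
  rfl

end Operators

/-! ## Relations on a module of level `κ` -/

namespace IsLevelModule

variable {ι : Type*} [Fintype ι] {C : CartanDatum ι} {h : ℂ} {κ : ℚ}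
variable {V : Type*} [AddCommGroup V] [Module ℂ V] [Module (Uq C h) V] [IsScalarTower ℂ (Uq C h) V]

theorem locallyBounded (hV : IsLevelModule C h κ V) : LocallyBounded (dOp C h V) := by
  intro v
  have hv : v ∈ ⨆ c : ℂ, homogeneous C h V c := hV.graded ▸ Submodule.mem_top
  induction hv using Submodule.iSup_induction' with
  | mem c v hv =>
    obtain ⟨n₀, hn₀⟩ := hV.bounded c
    refine ⟨n₀, fun n hn T hT => ?_⟩
    lift n to ℕ using by omega
    have hdv : dOp C h V v = c • v := Module.End.mem_eigenspace_iff.mp hv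
    have hTv : T v ∈ homogeneous C h V (c + n) := by
      have hdTv : dOp C h V (T v) = (c + n) • T v := by
        simpa [hdv, ← add_smul] using LinearMap.congr_fun (mem_degPart.mp hT) v
      exact Module.End.mem_eigenspace_iff.mpr hdTv
    simpa [hn₀ n (by omega)] using hTv
  | zero => exact ⟨0, fun n _ T _ => map_zero T⟩
  | add v w _ _ hv hw =>
    obtain ⟨N, hN⟩ := hv
    obtain ⟨N', hN'⟩ := hw
    refine ⟨max N N', fun n hn T hT => ?_⟩
    rw [map_add, hN n (by omega) T hT, hN' n (by omega) T hT, add_zero]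

theorem freeRep_gammaHalf (hV : IsLevelModule C h κ V) :
    freeRep C h V (Free.gen Gen.gammaHalf) = qpow h (κ / 2) • 1 :=
  LinearMap.ext hV.level

theorem freeRep_gammaHalfInv (hV : IsLevelModule C h κ V) :
    freeRep C h V (Free.gen Gen.gammaHalfInv) = (qpow h (κ / 2))⁻¹ • 1 := by
  have hinv := freeRep_rel (V := V) (Rel.gamma_inv_mul (C := C) (h := h))
  rw [map_mul, map_one, hV.freeRep_gammaHalf, mul_smul_comm, mul_one] at hinv
  rw [← hinv, inv_smul_smul₀ (qpow_ne_zero h _)]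

theorem freeRep_gammaHalfPow (hV : IsLevelModule C h κ V) (m : ℤ) :
    freeRep C h V (Free.gammaHalfPow m) = qpow h (κ / 2) ^ m • 1 := by
  rw [Free.gammaHalfPow, map_mul, map_pow, map_pow, hV.freeRep_gammaHalf, hV.freeRep_gammaHalfInv,
    smul_pow, smul_pow, one_pow, one_pow, smul_mul_smul_comm, one_mul]
  congr 1
  obtain ⟨n, rfl | rfl⟩ := m.eq_nat_or_neg <;> simp

theorem aOp_aOp (hV : IsLevelModule C h κ V) (i j : ι) (m n : ℤ) :
    aOp C h V i m * aOp C h V j n = aOp C h V j n * aOp C h V i m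
      + (if m = -n then qnum h (C.form i j * m) / m * qnum h (κ * m) else 0) •
        (1 : Module.End ℂ V) := by
  rcases eq_or_ne m 0 with rfl | hm
  · simp
  rcases eq_or_ne n 0 with rfl | hn
  · simp [hm]
  have hrel := freeRep_rel (V := V) (Rel.a_a (C := C) (h := h) i j m n hm hn)
  rw [map_sub, map_mul, map_mul, freeRep_a, freeRep_a, sub_eq_iff_eq_add'] at hrel
  rw [hrel]
  congr 1
  split_ifs with hmn
  · rw [map_smul, map_sub, hV.freeRep_gammaHalfPow, hV.freeRep_gammaHalfPow, ← sub_smul, smul_smul,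
      ← qpow_mul_intCast, ← qpow_mul_intCast]
    push_cast
    rw [show κ / 2 * (2 * m) = κ * m by ring, show κ / 2 * (-(2 * m)) = -(κ * m) by ring,
      div_mul_eq_mul_div, mul_div_assoc, ← qnum]
  · simp

theorem commute_aOp (hV : IsLevelModule C h κ V) (i j : ι) {m n : ℤ} (hmn : m ≠ -n) :
    Commute (aOp C h V i m) (aOp C h V j n) := by
  simpa [hmn, commute_iff_eq] using hV.aOp_aOp i j m n

theorem commute_aOp_natCast (hV : IsLevelModule C h κ V) (i j : ι) (m n : ℕ) :
    Commute (aOp C h V i m) (aOp C h V j n) := by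
  rcases eq_or_ne m 0 with rfl | hm
  · simp
  · exact hV.commute_aOp i j (by omega)

theorem commute_aOp_neg_natCast (hV : IsLevelModule C h κ V) (i j : ι) (m n : ℕ) :
    Commute (aOp C h V i (-m)) (aOp C h V j (-n)) := by
  rcases eq_or_ne m 0 with rfl | hm
  · simp
  · exact hV.commute_aOp i j (by omega)

end IsLevelModule

/-- The scalar `± [an]/n q^{∓κn/2}` in the bracket of `a_i(n)` or `a_i(-n)` with a component of
`x_j^±(z)`, where `a = (α_i|α_j)`. -/
def bracketCoeff (h : ℂ) (κ a : ℚ) (ε : ℤˣ) (n : ℕ) : ℂ :=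
  ((ε : ℤ) : ℂ) * (qnum h (a * n) / n) * qpow h (-(((ε : ℤ) : ℚ) * κ * n / 2))

namespace IsLevelModule

variable {ι : Type*} [Fintype ι] {C : CartanDatum ι} {h : ℂ} {κ : ℚ}
variable {V : Type*} [AddCommGroup V] [Module ℂ V] [Module (Uq C h) V] [IsScalarTower ℂ (Uq C h) V]

theorem aOp_xOp (hV : IsLevelModule C h κ V) (ε : ℤˣ) (i j : ι) {m : ℤ} {l : ℕ}
    (hl : m = l ∨ m = -l) (n : ℤ) :
    aOp C h V i m * xOp C h V ε j n = xOp C h V ε j n * aOp C h V i m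
      + bracketCoeff h κ (C.form i j) ε l • xOp C h V ε j (n + m) := by
  rcases eq_or_ne m 0 with rfl | hm
  · simp [show l = 0 by omega, bracketCoeff]
  have hrel := freeRep_rel (V := V) (Rel.a_x (C := C) (h := h) ε i j m n hm)
  rw [map_sub, map_mul, map_mul, freeRep_a, freeRep_x, sub_eq_iff_eq_add'] at hrel
  rw [hrel, map_smul, map_mul, freeRep_x, hV.freeRep_gammaHalfPow, smul_mul_assoc, one_mul,
    smul_smul, add_comm m n, bracketCoeff, show |m| = l by rcases hl with rfl | rfl <;> simp,
    ← qpow_mul_intCast]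
  have hqnum : qnum h (C.form i j * m) / m = qnum h (C.form i j * l) / l := by
    rcases hl with rfl | rfl <;> simp [qnum_neg]
  rw [hqnum]
  congr 4
  push_cast
  ring

theorem xOp_xOp_self (hV : IsLevelModule C h κ V) (i : ι) (m n : ℤ) :
    xOp C h V 1 i m * xOp C h V (-1) i n - xOp C h V (-1) i n * xOp C h V 1 i m
      = (qpow h (C.d i) - qpow h (-C.d i))⁻¹ •
        (qpow h (κ / 2) ^ (m - n) •
            (heisenbergDressing C h V i 0 fun _ => qpow h 1 - qpow h (-1)).dress
              (Pi.single 0 (kOp C h V i)) (m + n)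
          - (qpow h (κ / 2))⁻¹ ^ (m - n) •
            (heisenbergDressing C h V i (fun _ => qpow h (-1) - qpow h 1) 0).dress
              (Pi.single 0 (kInvOp C h V i)) (m + n)) := by
  rw [← freeRep_psi, ← freeRep_phi, inv_zpow', neg_sub]
  simpa only [map_sub, map_mul, map_smul, hV.freeRep_gammaHalfPow, smul_mul_assoc, one_mul,
    freeRep_x] using freeRep_rel (V := V) (Rel.x_plus_minus (C := C) (h := h) i m n)

theorem heisenbergDressing_mul (hV : IsLevelModule C h κ V) (i : ι) (α β α' β' : ℕ → ℂ) :
    heisenbergDressing C h V i α β * heisenbergDressing C h V i α' β'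
      = heisenbergDressing C h V i (α + α') (β + β') := by
  refine Dressing.ext (expSeries_mul (by simp) (hV.commute_aOp_neg_natCast i i) α α') ?_
  rw [add_comm β]
  exact expSeries_mul (by simp) (hV.commute_aOp_natCast i i) β' β

theorem coeffCommute_em (hV : IsLevelModule C h κ V) (i j : ι) (α β α' β' : ℕ → ℂ) :
    CoeffCommute (heisenbergDressing C h V i α β).em (heisenbergDressing C h V j α' β').em :=
  (coeffCommute_mk_smul (hV.commute_aOp_neg_natCast i j) α α').formalExp

theorem coeffCommute_ep (hV : IsLevelModule C h κ V) (i j : ι) (α β α' β' : ℕ → ℂ) :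
    CoeffCommute (heisenbergDressing C h V i α β).ep (heisenbergDressing C h V j α' β').ep :=
  (coeffCommute_mk_smul (hV.commute_aOp_natCast i j) β β').formalExp

theorem em_mul_C_xOp (hV : IsLevelModule C h κ V) (ε : ℤˣ) (i j : ι) (α β : ℕ → ℂ) (p : ℤ) :
    (heisenbergDressing C h V j α β).em * PowerSeries.C (xOp C h V ε i p)
      = (PowerSeries.mk fun r : ℕ =>
          coeff r (formalExp (PowerSeries.mk fun n => α n * bracketCoeff h κ (C.form j i) ε n)) •
            xOp C h V ε i (p - r)) * (heisenbergDressing C h V j α β).em := by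
  refine formalExp_mul_C_field (constantCoeff_mk_smul (by simp) α)
    (coeffCommute_mk_smul (hV.commute_aOp_neg_natCast j j) α α) ?_ (fun l p => ?_) p
  · simp [← coeff_zero_eq_constantCoeff_apply, bracketCoeff]
  · rw [coeff_mk, coeff_mk, smul_mul_assoc, hV.aOp_xOp ε j i (Or.inr rfl), smul_add, smul_smul,
      mul_smul_comm, sub_eq_add_neg]

end IsLevelModule

/-! ## The operators `Z_i^±(n)` -/

section ZOperators

variable {ι : Type*} [Fintype ι] (C : CartanDatum ι) (h : ℂ) (κ : ℚ)
variable (V : Type*) [AddCommGroup V] [Module ℂ V] [Module (Uq C h) V] [IsScalarTower ℂ (Uq C h) V]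

/-- The coefficients `± q^{∓κn/2} / [κn]` of `a_i(n) z^{-n}` in the exponent of `E_+^±(α_i, z)`. -/
def expCoeff (h : ℂ) (κ : ℚ) (ε : ℤˣ) (n : ℕ) : ℂ :=
  ((ε : ℤ) : ℂ) * (qpow h (-(((ε : ℤ) : ℚ) * κ * n / 2)) / qnum h (κ * n))

/-- The dressing by `E_-^±(α_i, z)` and `E_+^±(α_i, z)`. -/
def zDressing (ε : ℤˣ) (i : ι) : Dressing (dOp C h V) :=
  heisenbergDressing C h V i (fun n => -expCoeff h κ ε n) (expCoeff h κ ε)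

/-- The components of `Z^±(α_i, z) = E_-^±(α_i, z) x_i^±(z) E_+^±(α_i, z)`. -/
def zOp (ε : ℤˣ) (i : ι) : ℤ → Module.End ℂ V := (zDressing C h κ V ε i).dress (xOp C h V ε i)

theorem lsmul_coeff_EMinus (ε : ℤˣ) (i : ι) (n : ℕ) :
    Algebra.lsmul ℂ ℂ V (coeff n (EMinus C h κ ε i)) = coeff n (zDressing C h κ V ε i).em := by
  simp only [EMinus, neg_mul]
  exact map_coeff_expSeries (Algebra.lsmul ℂ ℂ V) _ _ n

theorem lsmul_coeff_EPlus (ε : ℤˣ) (i : ι) (n : ℕ) :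
    Algebra.lsmul ℂ ℂ V (coeff n (EPlus C h κ ε i)) = coeff n (zDressing C h κ V ε i).ep :=
  map_coeff_expSeries (Algebra.lsmul ℂ ℂ V) _ _ n

theorem zTerm_eq_term (ε : ℤˣ) (i : ι) (n : ℤ) (v : V) :
    zTerm C h κ ε i n v = fun p => (zDressing C h κ V ε i).term (xOp C h V ε i) n p v := by
  ext p
  rw [Dressing.term, ← lsmul_coeff_EMinus, ← lsmul_coeff_EPlus]
  rfl

variable {h κ}

theorem formalExp_contraction_self (a : ℚ) (ε : ℤˣ) :
    formalExp (PowerSeries.mk fun n => -expCoeff h κ ε n * bracketCoeff h κ a ε n)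
      = PowerSeries.rescale (qpow h (-(((ε : ℤ) : ℚ) * κ))) (qPochhammerPow h κ a) := by
  rw [qPochhammerPow, rescale_formalExp]
  congr 1
  ext n
  have hε : ((ε : ℤ) : ℂ) * ((ε : ℤ) : ℂ) = 1 := by
    rcases Int.units_eq_one_or ε with rfl | rfl <;> simp
  have hq : qpow h (-(((ε : ℤ) : ℚ) * κ * n / 2)) * qpow h (-(((ε : ℤ) : ℚ) * κ * n / 2))
      = qpow h (-(((ε : ℤ) : ℚ) * κ)) ^ n := by
    rw [← qpow_add, ← qpow_mul_natCast]
    ring_nf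
  rw [coeff_rescale, coeff_mk, coeff_mk, expCoeff, bracketCoeff, ← hq]
  linear_combination (-(qpow h (-(((ε : ℤ) : ℚ) * κ * n / 2)) ^ 2 * qnum h (a * n)
    / n / qnum h (κ * n))) * hε

theorem formalExp_contraction_neg (a : ℚ) (ε : ℤˣ) :
    formalExp (PowerSeries.mk fun n => -expCoeff h κ (-ε) n * bracketCoeff h κ a ε n)
      = qPochhammerPow h κ (-a) := by
  rw [qPochhammerPow]
  congr 1
  ext n
  have hε : ((ε : ℤ) : ℂ) * ((ε : ℤ) : ℂ) = 1 := by
    rcases Int.units_eq_one_or ε with rfl | rfl <;> simp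
  have hq : qpow h (((ε : ℤ) : ℚ) * κ * n / 2) * qpow h (-(((ε : ℤ) : ℚ) * κ * n / 2)) = 1 := by
    rw [← qpow_add, add_neg_cancel, qpow_zero]
  rw [coeff_mk, coeff_mk, expCoeff, bracketCoeff, neg_mul a, qnum_neg]
  push_cast
  rw [show -(-((ε : ℤ) : ℚ) * κ * n / 2) = ((ε : ℤ) : ℚ) * κ * n / 2 by ring]
  calc _ = (((ε : ℤ) : ℂ) * ((ε : ℤ) : ℂ)) *
        (qpow h (((ε : ℤ) : ℚ) * κ * n / 2) * qpow h (-(((ε : ℤ) : ℚ) * κ * n / 2))) *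
        (qnum h (a * n) / n / qnum h (κ * n)) := by ring
    _ = _ := by rw [hε, hq]; ring

theorem expCoeff_one (n : ℕ) : expCoeff h κ 1 n = (qpow h (κ / 2) ^ n)⁻¹ / qnum h (κ * n) := by
  rw [expCoeff, ← qpow_mul_natCast, ← qpow_neg]
  push_cast
  ring_nf

theorem expCoeff_neg_one (n : ℕ) :
    expCoeff h κ (-1) n = -(qpow h (κ / 2) ^ n / qnum h (κ * n)) := by
  rw [expCoeff, ← qpow_mul_natCast]
  push_cast
  ring_nf

theorem expCoeff_mul_qnum (hq : ∀ n : ℕ, 0 < n → Complex.exp h ^ n ≠ 1) (hκ : κ ≠ 0) (a : ℚ)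
    (ε : ℤˣ) (n : ℕ) :
    expCoeff h κ ε n * (qnum h (a * n) / n * qnum h (κ * n)) = bracketCoeff h κ a ε n := by
  rcases eq_or_ne n 0 with rfl | hn
  · simp [bracketCoeff]
  have hqnum := qnum_mul_natCast_ne_zero hq hκ hn
  rw [expCoeff, bracketCoeff]
  field_simp

theorem sq_sub_inv_sq_div_qnum (hq : ∀ n : ℕ, 0 < n → Complex.exp h ^ n ≠ 1) (hκ : κ ≠ 0) {n : ℕ}
    (hn : n ≠ 0) :
    ((qpow h (κ / 2) ^ n) ^ 2 - ((qpow h (κ / 2) ^ n)⁻¹) ^ 2) / qnum h (κ * n)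
      = qpow h 1 - qpow h (-1) := by
  rw [div_eq_iff (qnum_mul_natCast_ne_zero hq hκ hn), qnum,
    mul_div_cancel₀ _ (qpow_sub_qpow_neg_ne_zero hq one_ne_zero), ← qpow_mul_natCast, ← qpow_neg,
    ← qpow_mul_natCast, ← qpow_mul_natCast]
  ring_nf

variable {C V}

theorem IsLevelModule.isHomogeneousField_zOp (hV : IsLevelModule C h κ V) (ε : ℤˣ) (i : ι) :
    IsHomogeneousField (dOp C h V) 0 (zOp C h κ V ε i) :=
  Dressing.isHomogeneousField_dress hV.locallyBounded (isHomogeneousField_xOp C h V ε i)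

/-- The exponent of `E_-^±` is chosen so that its bracket with `a_i(m)` cancels the bracket of
`x_j^±(z)` with `a_i(m)`. -/
theorem IsLevelModule.C_aOp_mul_em (hV : IsLevelModule C h κ V)
    (hq : ∀ n : ℕ, 0 < n → Complex.exp h ^ n ≠ 1) (hκ : κ ≠ 0) (ε : ℤˣ) (i j : ι) {m : ℕ}
    (hm : m ≠ 0) :
    PowerSeries.C (aOp C h V i m) * (zDressing C h κ V ε j).em
      = (zDressing C h κ V ε j).em * PowerSeries.C (aOp C h V i m)
        - bracketCoeff h κ (C.form i j) ε m • (X ^ m * (zDressing C h κ V ε j).em) := by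
  rw [sub_eq_add_neg, ← neg_smul, ← smul_mul_assoc]
  refine mul_formalExp_of_bracket (constantCoeff_mk_smul (by simp) _)
    (coeffCommute_mk_smul (hV.commute_aOp_neg_natCast j j) _ _) (fun r s => ?_) ?_
  · rw [coeff_smul, coeff_X_pow]
    split_ifs
    · exact ((Commute.one_left _).smul_left _)
    · rw [smul_zero]
      exact Commute.zero_left _
  · ext1 r
    rw [coeff_C_mul, map_add, coeff_mul_C, coeff_mk, mul_smul_comm, hV.aOp_aOp, smul_add, smul_smul,
      smul_mul_assoc, coeff_smul, coeff_X_pow, neg_neg]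
    rcases eq_or_ne r m with rfl | hr
    · rw [if_pos rfl, if_pos rfl, ← expCoeff_mul_qnum hq hκ]
      push_cast
      ring_nf
    · rw [if_neg (by exact_mod_cast hr.symm), if_neg hr, mul_zero, zero_smul, smul_zero]

theorem IsLevelModule.commute_aOp_zOp (hV : IsLevelModule C h κ V)
    (hq : ∀ n : ℕ, 0 < n → Complex.exp h ^ n ≠ 1) (hκ : κ ≠ 0) (ε : ℤˣ) (i j : ι) (m : ℕ) (n : ℤ) :
    Commute (aOp C h V i m) (zOp C h κ V ε j n) := by
  rcases eq_or_ne m 0 with rfl | hm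
  · simp
  exact Dressing.commute_dress hV.locallyBounded (isHomogeneousField_xOp C h V ε j)
    (hV.C_aOp_mul_em hq hκ ε i j hm) (hV.aOp_xOp ε i j (Or.inl rfl))
    (commute_coeff_expSeries (hV.commute_aOp_natCast i j m) _) n

end ZOperators

/-! ## Relations between the operators `Z_i^±(n)` -/

section FormalSeries

variable {V : Type*} [AddCommGroup V] [Module ℂ V]

theorem mulSeriesWZ_mulLinear {P : ℂ⟦X⟧} {F : ℤ → ℤ → V}
    (hF : ∀ a b, (fun r : ℕ => coeff r P • F (a + r) (b - r)).HasFiniteSupport) (c₁ c₂ : ℂ) :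
    mulSeriesWZ P (mulLinear c₁ c₂ F) = mulLinear c₁ c₂ (mulSeriesWZ P F) := by
  ext a b
  have hc (c : ℂ) (a b : ℤ) : (fun r : ℕ => c • coeff r P • F (a + r) (b - r)).HasFiniteSupport :=
    Function.HasFiniteSupport.smul_right (fun _ => c) (hF a b)
  simp only [mulSeriesWZ, mulLinear]
  rw [smul_finsum' c₁ (hF (a - 1) b), smul_finsum' c₂ (hF a (b - 1)),
    ← finsum_sub_distrib (hc c₁ (a - 1) b) (hc c₂ a (b - 1))]
  refine finsum_congr fun r => ?_
  rw [smul_sub, smul_comm c₁, smul_comm c₂, sub_add_eq_add_sub, sub_right_comm b]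

theorem mulSeriesZW_mulLinear {P : ℂ⟦X⟧} {F : ℤ → ℤ → V}
    (hF : ∀ a b, (fun r : ℕ => coeff r P • F (a - r) (b + r)).HasFiniteSupport) (c₁ c₂ : ℂ) :
    mulSeriesZW P (mulLinear c₁ c₂ F) = mulLinear c₁ c₂ (mulSeriesZW P F) := by
  ext a b
  have hc (c : ℂ) (a b : ℤ) : (fun r : ℕ => c • coeff r P • F (a - r) (b + r)).HasFiniteSupport :=
    Function.HasFiniteSupport.smul_right (fun _ => c) (hF a b)
  simp only [mulSeriesZW, mulLinear]
  rw [smul_finsum' c₁ (hF (a - 1) b), smul_finsum' c₂ (hF a (b - 1)),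
    ← finsum_sub_distrib (hc c₁ (a - 1) b) (hc c₂ a (b - 1))]
  refine finsum_congr fun r => ?_
  rw [smul_sub, smul_comm c₁, smul_comm c₂, sub_add_eq_add_sub, sub_right_comm a]

variable {d : Module.End ℂ V} {X Y : ℤ → Module.End ℂ V} {k : ℤ}

theorem hasFiniteSupport_smul_prodZW (hd : LocallyBounded d) (hY : IsHomogeneousField d k Y)
    (P : ℂ⟦X⟧) (v : V) (a b : ℤ) :
    (fun r : ℕ => coeff r P • prodZW X Y v (a + r) (b - r)).HasFiniteSupport := by
  simp only [prodZW, neg_add', neg_sub', sub_neg_eq_add]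
  exact Dressing.pointwiseFinite_smul_mul hd hY P X (-a) (-b) v

theorem hasFiniteSupport_smul_prodWZ (hd : LocallyBounded d) (hX : IsHomogeneousField d k X)
    (P : ℂ⟦X⟧) (v : V) (a b : ℤ) :
    (fun r : ℕ => coeff r P • prodWZ Y X v (a - r) (b + r)).HasFiniteSupport :=
  hasFiniteSupport_smul_prodZW hd hX P v b a

theorem mulSeriesWZ_prodZW (hd : LocallyBounded d) (hY : IsHomogeneousField d k Y) (P : ℂ⟦X⟧)
    (v : V) (a b : ℤ) :
    mulSeriesWZ P (prodZW X Y v) a b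
      = pointwiseSum (fun u : ℕ => coeff u P • (X (-a - u) * Y (-b + u))) v := by
  rw [pointwiseSum_apply (Dressing.pointwiseFinite_smul_mul hd hY P X (-a) (-b))]
  refine finsum_congr fun u => ?_
  rw [prodZW, neg_add', neg_sub', sub_neg_eq_add]
  rfl

end FormalSeries

theorem smul_single_add_eq_delta_smul {V : Type*} [AddCommGroup V] [Module ℂ V] (h : ℂ) (a : ℚ)
    (m n : ℤ) (K : V) :
    qpow h (a / 2) ^ (m - n) • (Pi.single 0 K : ℤ → V) (m + n)
      = delta (qpow h (-a)) (-m) (-n) • K := by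
  by_cases hmn : m + n = 0
  · rw [hmn, Pi.single_eq_same, delta, if_pos (by omega), show m - n = 2 * m by omega,
      ← qpow_mul_intCast, ← qpow_mul_intCast]
    push_cast
    ring_nf
  · rw [Pi.single_eq_of_ne hmn, delta, if_neg (by omega), smul_zero, zero_smul]

namespace IsLevelModule

variable {ι : Type*} [Fintype ι] {C : CartanDatum ι} {h : ℂ} {κ : ℚ}
variable {V : Type*} [AddCommGroup V] [Module ℂ V] [Module (Uq C h) V] [IsScalarTower ℂ (Uq C h) V]

theorem isZOperator_zOp (hV : IsLevelModule C h κ V) : IsZOperator C h κ (zOp C h κ V) := by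
  intro ε i n v
  have hfin := Dressing.pointwiseFinite_term (E := zDressing C h κ V ε i) hV.locallyBounded
    (isHomogeneousField_xOp C h V ε i) n
  rw [zTerm_eq_term]
  exact ⟨hfin v, pointwiseSum_apply hfin v⟩

theorem zOp_truncated (hV : IsLevelModule C h κ V) (ε : ℤˣ) (i : ι) (v : V) :
    ∃ N : ℤ, ∀ n : ℤ, N < n → zOp C h κ V ε i n v = 0 := by
  obtain ⟨N, hN⟩ := hV.locallyBounded v
  exact ⟨N, fun n hn => hN n hn _ (by simpa using hV.isHomogeneousField_zOp ε i n)⟩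

theorem isHomogeneousField_xOp_mul_xOp (ε ε' : ℤˣ) (i j : ι) (m : ℤ) :
    IsHomogeneousField (dOp C h V) (0 + m) fun n => xOp C h V ε i m * xOp C h V ε' j n :=
  fun n => mul_mem_degPart (isHomogeneousField_xOp C h V ε i m)
    (isHomogeneousField_xOp C h V ε' j n) (by ring)

theorem isHomogeneousField_xOp_mul_xOp_swap (ε ε' : ℤˣ) (i j : ι) (m : ℤ) :
    IsHomogeneousField (dOp C h V) (0 + m) fun n => xOp C h V ε' j n * xOp C h V ε i m :=
  fun n => mul_mem_degPart (isHomogeneousField_xOp C h V ε' j n)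
    (isHomogeneousField_xOp C h V ε i m) (by ring)

theorem mulSeriesWZ_prodZW_zOp (hV : IsLevelModule C h κ V)
    (hq : ∀ n : ℕ, 0 < n → Complex.exp h ^ n ≠ 1) (hκ : κ ≠ 0) {ε ε' : ℤˣ} {i j : ι} {P : ℂ⟦X⟧}
    (hP : formalExp (PowerSeries.mk fun n =>
      -expCoeff h κ ε' n * bracketCoeff h κ (C.form j i) ε n) = P) (v : V) (a b : ℤ) :
    mulSeriesWZ P (prodZW (zOp C h κ V ε i) (zOp C h κ V ε' j) v) a b
      = (zDressing C h κ V ε i).dress₂ (zDressing C h κ V ε' j)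
          (fun m n => xOp C h V ε i m * xOp C h V ε' j n) (-a) (-b) v := by
  subst hP
  rw [mulSeriesWZ_prodZW hV.locallyBounded (hV.isHomogeneousField_zOp ε' j)]
  exact LinearMap.congr_fun (Dressing.pointwiseSum_smul_dress_mul_dress hV.locallyBounded
    (isHomogeneousField_xOp C h V ε i) (isHomogeneousField_xOp C h V ε' j)
    (hV.em_mul_C_xOp ε i j _ _) (fun s n => (commute_coeff_expSeries
      (fun m => (hV.commute_aOp_zOp hq hκ ε' i j m n).symm) _ s).symm) (-a) (-b)) v

theorem mulSeriesZW_prodWZ_zOp (hV : IsLevelModule C h κ V)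
    (hq : ∀ n : ℕ, 0 < n → Complex.exp h ^ n ≠ 1) (hκ : κ ≠ 0) {ε ε' : ℤˣ} {i j : ι} {P : ℂ⟦X⟧}
    (hP : formalExp (PowerSeries.mk fun n =>
      -expCoeff h κ ε n * bracketCoeff h κ (C.form i j) ε' n) = P) (v : V) (a b : ℤ) :
    mulSeriesZW P (prodWZ (zOp C h κ V ε' j) (zOp C h κ V ε i) v) a b
      = (zDressing C h κ V ε i).dress₂ (zDressing C h κ V ε' j)
          (fun m n => xOp C h V ε' j n * xOp C h V ε i m) (-a) (-b) v := by
  rw [← Dressing.dress₂_comm (E := zDressing C h κ V ε i) (E' := zDressing C h κ V ε' j)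
    hV.locallyBounded (isHomogeneousField_xOp_mul_xOp_swap ε ε' i j)
    (hV.coeffCommute_em i j _ _ _ _) (hV.coeffCommute_ep i j _ _ _ _)]
  exact hV.mulSeriesWZ_prodZW_zOp hq hκ hP v b a

theorem zOp_same_sign (hV : IsLevelModule C h κ V)
    (hq : ∀ n : ℕ, 0 < n → Complex.exp h ^ n ≠ 1) (hκ : κ ≠ 0) (ε : ℤˣ) (i j : ι) (v : V) :
    mulSeriesWZ
        (PowerSeries.rescale (qpow h (-(((ε : ℤ) : ℚ) * κ))) (qPochhammerPow h κ (C.form i j)))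
        (mulLinear 1 (qpow h (((ε : ℤ) : ℚ) * C.form i j))
          (prodZW (zOp C h κ V ε i) (zOp C h κ V ε j) v))
      = mulSeriesZW
        (PowerSeries.rescale (qpow h (-(((ε : ℤ) : ℚ) * κ))) (qPochhammerPow h κ (C.form i j)))
        (mulLinear (qpow h (((ε : ℤ) : ℚ) * C.form i j)) 1
          (prodWZ (zOp C h κ V ε j) (zOp C h κ V ε i) v)) := by
  have hd := hV.locallyBounded
  have hP : formalExp (PowerSeries.mk fun n =>
      -expCoeff h κ ε n * bracketCoeff h κ (C.form j i) ε n) = PowerSeries.rescale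
        (qpow h (-(((ε : ℤ) : ℚ) * κ))) (qPochhammerPow h κ (C.form i j)) := by
    rw [C.form_comm i j]
    exact formalExp_contraction_self (C.form j i) ε
  rw [mulSeriesWZ_mulLinear (hasFiniteSupport_smul_prodZW hd (hV.isHomogeneousField_zOp ε j) _ v),
    mulSeriesZW_mulLinear (hasFiniteSupport_smul_prodWZ hd (hV.isHomogeneousField_zOp ε i) _ v)]
  ext a b
  simp only [mulLinear, neg_sub', sub_neg_eq_add,
    hV.mulSeriesWZ_prodZW_zOp hq hκ hP,
    hV.mulSeriesZW_prodWZ_zOp hq hκ (formalExp_contraction_self (C.form i j) ε),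
    ← LinearMap.smul_apply, ← LinearMap.sub_apply]
  rw [← Dressing.dress₂_smul_shift_sub hd (isHomogeneousField_xOp_mul_xOp ε ε i j),
    ← Dressing.dress₂_smul_shift_sub hd (isHomogeneousField_xOp_mul_xOp_swap ε ε i j)]
  simp only [one_smul, xOp_xOp]

/-- The Cartan parts of `Z^+(α_i, z)` and `Z^-(α_i, w)` on the support of `δ(q^{-κ} z/w)` are
inverse to that of `ψ_i`. -/
theorem zDressing_scale_mul_psi (hV : IsLevelModule C h κ V)
    (hq : ∀ n : ℕ, 0 < n → Complex.exp h ^ n ≠ 1) (hκ : κ ≠ 0) (i : ι) :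
    (zDressing C h κ V 1 i).scale (qpow h (κ / 2)) *
        (zDressing C h κ V (-1) i).scale (qpow h (κ / 2))⁻¹ *
        heisenbergDressing C h V i 0 (fun _ => qpow h 1 - qpow h (-1)) = 1 := by
  rw [zDressing, zDressing, scale_heisenbergDressing, scale_heisenbergDressing,
    hV.heisenbergDressing_mul, hV.heisenbergDressing_mul]
  refine heisenbergDressing_eq_one C h V i (fun n _ => ?_) fun n hn => ?_ <;>
    simp only [Pi.add_apply, Pi.zero_apply, expCoeff_one, expCoeff_neg_one, inv_inv, inv_pow]
  · ring
  · rw [← sq_sub_inv_sq_div_qnum hq hκ hn]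
    ring

theorem zDressing_scale_mul_phi (hV : IsLevelModule C h κ V)
    (hq : ∀ n : ℕ, 0 < n → Complex.exp h ^ n ≠ 1) (hκ : κ ≠ 0) (i : ι) :
    (zDressing C h κ V 1 i).scale (qpow h (κ / 2))⁻¹ *
        (zDressing C h κ V (-1) i).scale (qpow h (κ / 2))⁻¹⁻¹ *
        heisenbergDressing C h V i (fun _ => qpow h (-1) - qpow h 1) 0 = 1 := by
  rw [zDressing, zDressing, scale_heisenbergDressing, scale_heisenbergDressing,
    hV.heisenbergDressing_mul, hV.heisenbergDressing_mul]
  refine heisenbergDressing_eq_one C h V i (fun n hn => ?_) fun n _ => ?_ <;>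
    simp only [Pi.add_apply, Pi.zero_apply, expCoeff_one, expCoeff_neg_one, inv_inv, inv_pow]
  · rw [← neg_sub (qpow h 1), ← sq_sub_inv_sq_div_qnum hq hκ hn]
    ring
  · ring

theorem dress₂_xOp_commutator (hV : IsLevelModule C h κ V)
    (hq : ∀ n : ℕ, 0 < n → Complex.exp h ^ n ≠ 1) (hκ : κ ≠ 0) (i : ι) (m n : ℤ) :
    (zDressing C h κ V 1 i).dress₂ (zDressing C h κ V (-1) i) (fun m n =>
        xOp C h V 1 i m * xOp C h V (-1) i n - xOp C h V (-1) i n * xOp C h V 1 i m) m n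
      = (qpow h (C.d i) - qpow h (-C.d i))⁻¹ •
        (delta (qpow h (-κ)) (-m) (-n) • kOp C h V i
          - delta (qpow h κ) (-m) (-n) • kInvOp C h V i) := by
  have hd := hV.locallyBounded
  have hc := qpow_ne_zero h (κ / 2)
  have hK := Dressing.isHomogeneousField_single (kOp_mem C h V i)
  have hKInv := Dressing.isHomogeneousField_single (kInvOp_mem C h V i)
  have hψ := (Dressing.isHomogeneousField_dress
    (E := heisenbergDressing C h V i 0 fun _ => qpow h 1 - qpow h (-1)) hd hK).zpow_smul_add
    (qpow h (κ / 2))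
  have hφ := (Dressing.isHomogeneousField_dress
    (E := heisenbergDressing C h V i (fun _ => qpow h (-1) - qpow h 1) 0) hd hKInv).zpow_smul_add
    (qpow h (κ / 2))⁻¹
  simp only [hV.xOp_xOp_self]
  rw [Dressing.dress₂_smul hd fun m n => Submodule.sub_mem _ (hψ m n) (hφ m n),
    Dressing.dress₂_sub hd hψ hφ,
    Dressing.dress₂_zpow_smul_dress hd hK hc (hV.zDressing_scale_mul_psi hq hκ i),
    Dressing.dress₂_zpow_smul_dress hd hKInv (inv_ne_zero hc)
      (hV.zDressing_scale_mul_phi hq hκ i),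
    ← qpow_neg, ← neg_div, smul_single_add_eq_delta_smul, smul_single_add_eq_delta_smul, neg_neg]

theorem zOp_mixed_sign [DecidableEq ι] (hV : IsLevelModule C h κ V)
    (hq : ∀ n : ℕ, 0 < n → Complex.exp h ^ n ≠ 1) (hκ : κ ≠ 0) (i j : ι) (v : V) (a b : ℤ) :
    mulSeriesWZ (qPochhammerPow h κ (-C.form i j))
          (prodZW (zOp C h κ V 1 i) (zOp C h κ V (-1) j) v) a b
        - mulSeriesZW (qPochhammerPow h κ (-C.form i j))
          (prodWZ (zOp C h κ V (-1) j) (zOp C h κ V 1 i) v) a b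
      = if i = j then
          (qpow h (C.d i) - qpow h (-C.d i))⁻¹ •
            (delta (qpow h (-κ)) a b • kOp C h V i v - delta (qpow h κ) a b • kInvOp C h V i v)
        else 0 := by
  have hWZ : formalExp (PowerSeries.mk fun n =>
      -expCoeff h κ (-1) n * bracketCoeff h κ (C.form j i) 1 n)
        = qPochhammerPow h κ (-C.form i j) := by
    rw [C.form_comm i j]
    exact formalExp_contraction_neg (C.form j i) 1
  have hZW : formalExp (PowerSeries.mk fun n =>
      -expCoeff h κ 1 n * bracketCoeff h κ (C.form i j) (-1) n)
        = qPochhammerPow h κ (-C.form i j) := by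
    simpa only [neg_neg] using formalExp_contraction_neg (h := h) (κ := κ) (C.form i j) (-1)
  rw [hV.mulSeriesWZ_prodZW_zOp hq hκ hWZ, hV.mulSeriesZW_prodWZ_zOp hq hκ hZW]
  split_ifs with hij
  · subst hij
    rw [← LinearMap.sub_apply, ← Dressing.dress₂_sub hV.locallyBounded
      (isHomogeneousField_xOp_mul_xOp 1 (-1) i i) (isHomogeneousField_xOp_mul_xOp_swap 1 (-1) i i),
      hV.dress₂_xOp_commutator hq hκ, neg_neg, neg_neg]
    rfl
  · simp only [(commute_xOp_of_ne C h V hij _ _).eq, sub_self]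

end IsLevelModule

end QuantumZ

end

/-- `q = e^h` is not a root of unity, `κ` is a nonzero rational level. -/
theorem theorem2p2 {ι : Type*} [Fintype ι] [DecidableEq ι] (C : QuantumZ.CartanDatum ι)
    (h : ℂ) (hq : ∀ n : ℕ, 0 < n → Complex.exp h ^ n ≠ 1)
    (κ : ℚ) (hκ : κ ≠ 0)
    (V : Type*) [AddCommGroup V] [Module ℂ V] [Module (QuantumZ.Uq C h) V]
    [IsScalarTower ℂ (QuantumZ.Uq C h) V]
    (hV : QuantumZ.IsLevelModule C h κ V) :
    ∃ Z : ℤˣ → ι → ℤ → Module.End ℂ V,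
      QuantumZ.IsZOperator C h κ Z ∧
      QuantumZ.QuantumZRelations C h κ
        (fun i => Algebra.lsmul ℂ ℂ V (QuantumZ.Uq.k C h i))
        (fun i => Algebra.lsmul ℂ ℂ V (QuantumZ.Uq.kInv C h i))
        Z :=
  ⟨QuantumZ.zOp C h κ V, hV.isZOperator_zOp,
    { truncated := hV.zOp_truncated
      same_sign := hV.zOp_same_sign hq hκ
      mixed_sign := hV.zOp_mixed_sign hq hκ }⟩
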